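/- **Setting.** Let $n\ge 1$, let $Y_1,\dots,Y_n\in\{0,1\}$ be independent random variables, and let $\epsilon_i:=Y_i-\mathbb E Y_i$. For $f\in\mathbb R^n$ put $(Df)_k:=f_k-f_{k-1}$ ($2\le k\le n$), $\mathrm{TV}(f):=\sum_{k=2}^n|(Df)_k|$ and $\|f\|_{Q_n}^2:=\frac1n\sum_{i=1}^n f_i^2$. *The constant $A_0$.* For $\mathcal G\subset\mathbb R^m$, $u>0$ and a probability measure $\mathbf Q$ on $\{1,\dots,m\}$, let $H(u,\mathcal G,\mathbf Q)$ be the logarithm of the smallest number of points of $\mathcal G$ whose closed $u$-balls in $L_2(\mathbf Q)$ cover $\mathcal G$. Call $A_0$ an *entropy constant* if $H\bigl(u,\{g\in\mathbb R^m:\|g\|_\infty\le1,\ \mathrm{TV}(g)\le1\},\mathbf Q\bigr)\le A_0/u$ for all $u>0$, all $m$ and all $\mathbf Q$. *Weights.* Fix $\mathbf f\in\mathbb R^n$ with jump set $S=\{k\in\{2,\dots,n\}:\mathbf f_k\ne\mathbf f_{k-1}\}=\{t_1<\dots<t_s\}$, where $t_s<n$, and let $t_0:=1$, $t_{s+1}:=n+1$,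 $d_j:=t_j-t_{j-1}$. For $2\le k\le n$ let $w_k\geq 0$ be given by $$w_k^2:=\frac{k-t_{j-1}}{d_j}\cdot\frac{t_j-k}{n}\quad(t_{j-1}<k<t_j,\ 1\le j\le s+1),\qquad w_{k}^2:=\frac1n\quad(k\in S),$$ and let $\|w^{-1}\|_{Q_n}^2:=\frac1n\sum_{k=2}^n w_k^{-2}$, $\|Dw\|_2^2:=\sum_{k=3}^n(w_k-w_{k-1})^2$ and $\|w_{-S}D_{-S}f\|_1:=\sum_{2\le k\le n,\,k\notin S}w_k|(Df)_k|$. **Theorem.** Entropy constants exist. Let $A_0$ be any entropy constant, let $\nu>0$, $\mu>0$, $t>0$, write $L:=1+t+\log(3+2\log_2 n)$, and let $\delta_n^2(t)$ and $\lambda_n(t)$ be any numbers with $$\delta_n^2(t)\ \ge\ \Bigl(\frac{4\nu A_0\|w^{-1}\|_{Q_n}}{\sqrt n}+8\sqrt{\frac{L}{n}}\Bigr)^2+\Bigl(\frac1{2\nu}+4\sqrt{\frac{A_0\|w^{-1}\|_{Q_n}/\sqrt n}{n}}+\frac{4\sqrt{L}}{n}\Bigr)\Bigl(\|Dw\|_2+2\sqrt{\frac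 sn}\Bigr)^2,$$ $$\lambda_n(t)\ \ge\ \frac1{\sqrt n}\Bigl(\frac4\nu+8\sqrt{\frac{A_0\|w^{-1}\|_{Q_n}/\sqrt n}{n}}+\frac{8\sqrt{L}}{n}\Bigr).$$ Then with probability at least $1-e^{-t}$, simultaneously for all $f\in\mathbb R^n$, $$\frac{\epsilon^Tf}{n}\ \le\ \mu\,\delta_n^2(t)+\frac{\|f\|_{Q_n}^2}{\mu}+\lambda_n(t)\,\|w_{-S}D_{-S}f\|_1 .$$ -/

import Mathlib

open MeasureTheory ProbabilityTheory

namespace TVLogit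

noncomputable section

/-- The entry `f_k` of a vector `f ∈ ℝⁿ`, with the indexing `k = 1, …, n`
(and `0` outside this range, which is never used). -/
def entry {n : ℕ} (f : Fin n → ℝ) (k : ℕ) : ℝ :=
  if h : 1 ≤ k ∧ k ≤ n then f ⟨k - 1, by omega⟩ else 0

/-- The difference `(D f)_k = f_k - f_{k-1}`, used for `k = 2, …, n`. -/
def diff {n : ℕ} (f : Fin n → ℝ) (k : ℕ) : ℝ := entry f k - entry f (k - 1)

/-- The total variation `TV(f) = ∑_{k=2}^n |f_k - f_{k-1}|`. -/
def TV {n : ℕ} (f : Fin n → ℝ) : ℝ := ∑ k ∈ Finset.Icc 2 n, |diff f k|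

/-- The squared normalized Euclidean norm `‖f‖²_{Q_n} = ‖f‖₂² / n`. -/
def normQnSq {n : ℕ} (f : Fin n → ℝ) : ℝ := (∑ i, f i ^ 2) / n

/-! ### Entropy and the universal constant -/

/-- The `u`-covering number of `V` for a distance function `d`: the smallest size of a finite set of
centres in `V` whose closed `u`-balls cover `V` (`⊤` if there is none). -/
def coveringNumber {E : Type*} (d : E → E → ℝ) (V : Set E) (u : ℝ) : ℕ∞ :=
  ⨅ (C : Finset E) (_ : (C : Set E) ⊆ V ∧ ∀ v ∈ V, ∃ c ∈ C, d v c ≤ u), (C.card : ℕ∞)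

/-- The entropy: the logarithm of the covering number. -/
def entropy {E : Type*} (d : E → E → ℝ) (V : Set E) (u : ℝ) : EReal :=
  ENNReal.log ((coveringNumber d V u : ℕ∞) : ENNReal)

/-- The distance of the `L₂(Q)`-norm on `ℝⁿ`, for a measure `Q` on the index set. -/
def distL2 {n : ℕ} (Q : Measure (Fin n)) (g h : Fin n → ℝ) : ℝ :=
  √(∫ i, (g i - h i) ^ 2 ∂Q)

/-- The vectors with `‖g‖_∞ ≤ 1` and `TV(g) ≤ 1`. -/
def boundedTV (n : ℕ) : Set (Fin n → ℝ) := {g | (∀ i, |g i| ≤ 1) ∧ TV g ≤ 1}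

/-- `A₀` bounds the entropy of the vectors with sup-norm and total variation at most `1` by `A₀ / u`,
whatever the dimension `n`, the probability measure `Q` on the indices and the radius `u > 0`. -/
def IsEntropyConstant (A₀ : ℝ) : Prop :=
  ∀ (n : ℕ) (Q : Measure (Fin n)), IsProbabilityMeasure Q → ∀ u : ℝ, 0 < u →
    entropy (distL2 Q) (boundedTV n) u ≤ ((A₀ / u : ℝ) : EReal)

/-! ### Jumps and weights -/

/-- The jump locations `S ⊆ {2, …, n}` of a vector. -/
def jumpSet {n : ℕ} (f : Fin n → ℝ) : Finset ℕ :=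
  {k ∈ Finset.Icc 2 n | entry f k ≠ entry f (k - 1)}

/-- For `1 ≤ k ≤ n`: the last of the points `t₀ = 1, t₁, …, t_s` that is at most `k`. -/
def leftEnd (S : Finset ℕ) (k : ℕ) : ℕ := sSup {τ | (τ = 1 ∨ τ ∈ S) ∧ τ ≤ k}

/-- For `1 ≤ k ≤ n`: the first of the points `t₁, …, t_s, t_{s+1} = n + 1` that exceeds `k`. -/
def rightEnd (n : ℕ) (S : Finset ℕ) (k : ℕ) : ℕ := sInf {τ | (τ = n + 1 ∨ τ ∈ S) ∧ k < τ}

/-- The weight `w_k`, used for `k = 2, …, n`: `w_k² = 1/n` at a jump, and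
`w_k² = ((k - t_{j-1}) / d_j) ((t_j - k) / n)` for `t_{j-1} < k < t_j`, with `d_j = t_j - t_{j-1}`. -/
def weight (n : ℕ) (S : Finset ℕ) (k : ℕ) : ℝ :=
  if k ∈ S then √(1 / (n : ℝ))
  else √((((k : ℝ) - leftEnd S k) / ((rightEnd n S k : ℝ) - leftEnd S k)) *
    (((rightEnd n S k : ℝ) - k) / n))

/-- `‖w⁻¹‖_{Q_n}`, over the indices `2, …, n` at which weights are defined. -/
def invWeightNorm (n : ℕ) (S : Finset ℕ) : ℝ :=
  √((∑ k ∈ Finset.Icc 2 n, (1 / weight n S k) ^ 2) / n)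

/-- `‖D w‖₂`, over the successive weights `w₂, …, w_n`. -/
def diffWeightNorm (n : ℕ) (S : Finset ℕ) : ℝ :=
  √(∑ k ∈ Finset.Icc 3 n, (weight n S k - weight n S (k - 1)) ^ 2)

/-- `‖w_{-S} D_{-S} f‖₁ = ∑_{k ∉ S} |w_k (f_k - f_{k-1})|`. -/
def weightedTV {n : ℕ} (S : Finset ℕ) (f : Fin n → ℝ) : ℝ :=
  ∑ k ∈ Finset.Icc 2 n \ S, |weight n S k * diff f k|

/-- The quantity `1 + t + log(3 + 2 log₂ n)`. -/
def confidence (n : ℕ) (t : ℝ) : ℝ := 1 + t + Real.log (3 + 2 * Real.logb 2 n)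

/-- The lower bound required of `δ_n²(t)`. -/
def deltaSqBound (A₀ ν : ℝ) (n : ℕ) (S : Finset ℕ) (t : ℝ) : ℝ :=
  (4 * ν * A₀ * invWeightNorm n S / √n + 8 * √(confidence n t / n)) ^ 2
    + (1 / (2 * ν) + 4 * √((A₀ * invWeightNorm n S / √n) / n) + 4 * √(confidence n t) / n)
      * (diffWeightNorm n S + 2 * √((S.card : ℝ) / n)) ^ 2

/-- The lower bound required of `λ_n(t)`. -/
def lambdaBound (A₀ ν : ℝ) (n : ℕ) (S : Finset ℕ) (t : ℝ) : ℝ :=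
  1 / √n *
    (4 / ν + 8 * √((A₀ * invWeightNorm n S / √n) / n) + 8 * √(confidence n t) / n)

/-- The noise `ε_i = Y_i - 𝔼 Y_i`. -/
def noise {Ω : Type*} [MeasurableSpace Ω] (P : Measure Ω) {n : ℕ} (Y : Fin n → Ω → ℝ)
    (i : Fin n) (ω : Ω) : ℝ := Y i ω - ∫ ω', Y i ω' ∂P

end

end TVLogit

/-!
The noise is compared with its penalty through the functional

  `V(e) = sup { ⟨e, f⟩ - n λ ‖w_{-S} D_{-S} f‖₁ : ‖f‖₂ ≤ 1 }`,

the `penSup` of the weighted total variation. By homogeneity in `f`, a bound `V(ε) ≤ b` gives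
`⟨ε, f⟩ ≤ b ‖f‖₂ + n λ ‖w_{-S} D_{-S} f‖₁` for all `f` at once, and
`b ‖f‖₂ ≤ μ b² / 4 + ‖f‖₂² / μ`; hence `b² ≤ 4 n δ_n²(t)` suffices.

*Fluctuations.* `V` is convex and `1`-Lipschitz, as a supremum of affine functions with slopes in the
unit ball. Maurey's inequality for the biased discrete cube (`maurey`: a two-point inequality and
induction on the dimension) therefore gives `V(ε) ≤ 𝔼 V(ε) + 2 √t` with probability at least
`1 - e⁻ᵗ` (`convex_lipschitz_concentration`). No chaining and no peeling is needed for the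
uniformity in `f`.

*Expectation.* The jumps cut `{1, …, n}` into blocks, and each block is cut into two halves. Seen from
its end of the block, a half is an interval `{0, …, c - 1}` on which the penalty of the increment at
distance `t` is at least `T √t`, with `T² = 8 / ν²` (`penalty_le`). The scalar product on such an
interval is expanded in an unbalanced Haar basis (`sum_mul_eq_haar`). Haar coefficients of `f` are
controlled by its increments, so that the noise coefficients below suitable thresholds `thr` are
absorbed by the penalty (`sum_thr_mul_haarKernel_le`); the thresholds grow like the fourth root of
the position of the block. The means and the coefficients above the thresholds form the `energy`,
which bounds the rest by the Cauchy-Schwarz inequality (`sum_mul_le_energy`). Second and tenth moments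
of linear forms in the noise show that the expected energy is `O(1)` per block plus `O(ν²)` per dyadic
level (`integral_energy_le`). The numbers of jumps and of levels are at most of the order of
`‖w⁻¹‖²`, since the inverse squared weights of a block form harmonic sums (`card_add_levels_le`).
With `A₀ ≥ 5/8` this is within `4 n δ_n²(t)` (`energy_numeric`), which yields `noise_bound`.

*Entropy constants.* Every entropy constant is at least `5/8`, because in dimension one `[-1, 1]` is
not covered by one ball of radius `19/20` (`IsEntropyConstant.le`). That entropy constants exist
(`isEntropyConstant_352`) follows from the Jordan decomposition and an encoding of increasing
functions at all scales at once: the `Q`-masses of the sublevel sets at the multiples of `2ⁱ⁻ʳ` are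
recorded with precision `2⁻ʳ⁻²ⁱ`. Equal `code`s force the distance in `L₂(Q)` to be `O(2⁻ʳ)`
(`sum_sq_sub_le`), while there are only `exp (O(2ʳ))` of them (`prod_choose_le_exp`).
-/

namespace TVLogit

/-! ### Maurey's inequality on the biased discrete cube -/

lemma exp_sub_sq_add_exp_neg_le {d : ℝ} (h0 : 0 ≤ d) (h1 : d ≤ 1 / 2) :
    Real.exp (d - d ^ 2) + Real.exp (-d) ≤ 2 := by
  have hx0 : 0 ≤ d - d ^ 2 := by nlinarith
  have hx1 : d - d ^ 2 ≤ 1 := by nlinarith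
  have h2 := Real.exp_bound' hx0 hx1 (n := 3) (by norm_num)
  have h3 : Real.exp (-d) ≤ 1 - d + d ^ 2 / 2 := by
    rw [Real.exp_neg, inv_le_comm₀ (Real.exp_pos _) (by nlinarith)]
    refine le_trans ?_ (Real.quadratic_le_exp_of_nonneg h0)
    rw [inv_le_iff_one_le_mul₀ (by nlinarith)]
    nlinarith [pow_nonneg h0 4]
  norm_num [Finset.sum_range_succ, Nat.factorial] at h2
  have h5 : (d - d ^ 2) ^ 3 ≤ d ^ 3 := pow_le_pow_left₀ hx0 (by nlinarith) 3
  have h6 : d ^ 4 ≤ d ^ 3 * (1 / 2) := by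
    rw [pow_succ]; exact mul_le_mul_of_nonneg_left h1 (by positivity)
  have h7 : 0 ≤ d ^ 3 := by positivity
  nlinarith

/-- The two-point case of Maurey's inequality. The points carry the weights `1 - q` and `q` and the
values `a ≤ b`; `X₀`, `X₁` stand for the exponentials of the infimal convolution, which at the
second point may be estimated by any interpolation `(1 - s) b + s a` at the cost `s² / 4`. -/
lemma two_point_maurey {q a b X₀ X₁ : ℝ} (hq0 : 0 ≤ q) (hq1 : q ≤ 1) (hab : a ≤ b)
    (h0 : X₀ ≤ Real.exp a)
    (h1 : ∀ s : ℝ, 0 ≤ s → s ≤ 1 → X₁ ≤ Real.exp (s ^ 2 / 4 + (1 - s) * b + s * a)) :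
    ((1 - q) * X₀ + q * X₁) * ((1 - q) * Real.exp (-a) + q * Real.exp (-b)) ≤ 1 := by
  obtain ⟨d, rfl⟩ : ∃ d, b = a + d := ⟨b - a, by ring⟩
  have hd : 0 ≤ d := by linarith
  obtain ⟨u, hu1, hu2, hu3⟩ : ∃ u, X₁ ≤ Real.exp (a + u) ∧ u ≤ d ∧
      Real.exp u + Real.exp (-d) ≤ 2 := by
    by_cases hd2 : d ≤ 1 / 2
    · refine ⟨d - d ^ 2, ?_, by nlinarith, exp_sub_sq_add_exp_neg_le hd hd2⟩
      refine (h1 (2 * d) (by linarith) (by linarith)).trans (le_of_eq ?_)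
      congr 1; ring
    · push Not at hd2
      refine ⟨1 / 4, ?_, by linarith, ?_⟩
      · refine (h1 1 (by norm_num) le_rfl).trans (le_of_eq ?_)
        congr 1; ring
      · have e1 := Real.exp_bound' (x := 1 / 4) (by norm_num) (by norm_num) (n := 3) (by norm_num)
        norm_num [Finset.sum_range_succ, Nat.factorial] at e1
        have e2 : Real.exp (-d) ≤ 2 / 3 := by
          rw [Real.exp_neg, inv_le_comm₀ (Real.exp_pos _) (by norm_num)]
          have := Real.add_one_le_exp d
          norm_num; linarith
        linarith
  have hX : (1 - q) * X₀ + q * X₁ ≤ Real.exp a * ((1 - q) + q * Real.exp u) := by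
    have := mul_le_mul_of_nonneg_left h0 (sub_nonneg.2 hq1)
    have := mul_le_mul_of_nonneg_left hu1 hq0
    rw [Real.exp_add] at this
    linarith
  have hA : (1 - q) * Real.exp (-a) + q * Real.exp (-(a + d))
      = Real.exp (-a) * ((1 - q) + q * Real.exp (-d)) := by
    rw [neg_add, Real.exp_add]; ring
  have hpos : 0 ≤ (1 - q) + q * Real.exp (-d) := by
    have := mul_nonneg hq0 (Real.exp_pos (-d)).le
    linarith
  rw [hA]
  calc _ ≤ Real.exp a * ((1 - q) + q * Real.exp u) *
        (Real.exp (-a) * ((1 - q) + q * Real.exp (-d))) := by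
        apply mul_le_mul_of_nonneg_right hX
        exact mul_nonneg (Real.exp_pos _).le hpos
    _ = (Real.exp a * Real.exp (-a)) * ((1 - q) ^ 2 + q * (1 - q) *
          (Real.exp u + Real.exp (-d)) + q ^ 2 * (Real.exp u * Real.exp (-d))) := by ring
    _ ≤ 1 := by
        rw [← Real.exp_add, ← Real.exp_add, add_neg_cancel, Real.exp_zero, one_mul]
        have e3 : Real.exp (u + -d) ≤ 1 := Real.exp_le_one_iff.2 (by linarith)
        have e4 := mul_le_mul_of_nonneg_left hu3 (mul_nonneg hq0 (sub_nonneg.2 hq1))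
        have e5 := mul_le_mul_of_nonneg_left e3 (sq_nonneg q)
        nlinarith

/-- The expectation of `h` under the product of the Bernoulli distributions with parameters `p i`,
as a finite sum over the discrete cube. -/
noncomputable def bernExp {n : ℕ} (p : Fin n → ℝ) (h : (Fin n → ℝ) → ℝ) : ℝ :=
  ∑ x : Fin n → Bool, (∏ i, if x i then p i else 1 - p i) * h (fun i => if x i then 1 else 0)

lemma bernExp_succ {n : ℕ} (p : Fin (n + 1) → ℝ) (h : (Fin (n + 1) → ℝ) → ℝ) :
    bernExp p h = (1 - p 0) * bernExp (Fin.tail p) (fun y => h (Fin.cons 0 y))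
      + p 0 * bernExp (Fin.tail p) (fun y => h (Fin.cons 1 y)) := by
  unfold bernExp
  rw [← (Fin.consEquiv (fun _ => Bool)).sum_comp, Fintype.sum_prod_type]
  simp only [Fintype.sum_bool, Fin.prod_univ_succ, Fin.consEquiv_apply, Fin.cons_zero, Fin.cons_succ,
    Finset.mul_sum]
  rw [add_comm]
  have key : ∀ (b : Bool) (x : Fin n → Bool),
      (fun i => if (Fin.cons b x : Fin (n + 1) → Bool) i then (1 : ℝ) else 0)
        = Fin.cons (if b then 1 else 0) (fun i => if x i then 1 else 0) := by
    intro b x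
    funext i
    refine Fin.cases ?_ (fun j => ?_) i <;> simp
  congr 1 <;>
  · refine Finset.sum_congr rfl fun x _ => ?_
    rw [key]
    simp [Fin.tail, mul_assoc]

lemma bernExp_mono {n : ℕ} {p : Fin n → ℝ} (hp : ∀ i, 0 ≤ p i ∧ p i ≤ 1)
    {h h' : (Fin n → ℝ) → ℝ} (hh : ∀ x, h x ≤ h' x) : bernExp p h ≤ bernExp p h' := by
  unfold bernExp
  refine Finset.sum_le_sum fun x _ => mul_le_mul_of_nonneg_left (hh _) ?_
  refine Finset.prod_nonneg fun i _ => ?_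
  split_ifs
  · exact (hp i).1
  · linarith [(hp i).2]

lemma bernExp_linear {n : ℕ} (p : Fin n → ℝ) (a b : ℝ) (h h' : (Fin n → ℝ) → ℝ) :
    bernExp p (fun x => a * h x + b * h' x) = a * bernExp p h + b * bernExp p h' := by
  unfold bernExp
  rw [Finset.mul_sum, Finset.mul_sum, ← Finset.sum_add_distrib]
  exact Finset.sum_congr rfl fun x _ => by ring

lemma bernExp_const_mul {n : ℕ} (p : Fin n → ℝ) (a : ℝ) (h : (Fin n → ℝ) → ℝ) :
    bernExp p (fun x => a * h x) = a * bernExp p h := by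
  simpa using bernExp_linear p a 0 h h

lemma bernExp_pos {n : ℕ} {p : Fin n → ℝ} (hp : ∀ i, 0 ≤ p i ∧ p i ≤ 1)
    {h : (Fin n → ℝ) → ℝ} (hh : ∀ x, 0 < h x) : 0 < bernExp p h := by
  induction n with
  | zero => simpa [bernExp] using hh _
  | succ n ih =>
    rw [bernExp_succ]
    have h0 := ih (p := Fin.tail p) (fun i => hp i.succ) (h := fun y => h (Fin.cons 0 y))
      (fun x => hh _)
    have h1 := ih (p := Fin.tail p) (fun i => hp i.succ) (h := fun y => h (Fin.cons 1 y))
      (fun x => hh _)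
    obtain ⟨a, b⟩ := hp 0
    rcases a.eq_or_lt with a | a
    · rw [← a]; simpa using h0
    · have := mul_nonneg (sub_nonneg.2 b) h0.le
      have := mul_pos a h1
      linarith

/-- The infimal convolution of `F` with the quadratic cost `‖x - y‖² / 4`. -/
noncomputable def infConv {n : ℕ} (F : (Fin n → ℝ) → ℝ) (x : Fin n → ℝ) : ℝ :=
  ⨅ y : Fin n → ℝ, F y + (∑ i, (x i - y i) ^ 2) / 4

lemma bddBelow_infConv {n : ℕ} {F : (Fin n → ℝ) → ℝ} (hF : ∀ y, 0 ≤ F y) (x : Fin n → ℝ) :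
    BddBelow (Set.range fun y : Fin n → ℝ => F y + (∑ i, (x i - y i) ^ 2) / 4) := by
  refine ⟨0, ?_⟩
  rintro _ ⟨y, rfl⟩
  have := hF y
  positivity

lemma infConv_le {n : ℕ} {F : (Fin n → ℝ) → ℝ} (hF : ∀ y, 0 ≤ F y) (x y : Fin n → ℝ) :
    infConv F x ≤ F y + (∑ i, (x i - y i) ^ 2) / 4 :=
  ciInf_le (bddBelow_infConv hF x) y

/-- Convexity of `F` turns near-minimizers for two slices into a competitor on the segment between
the slices. -/
lemma infConv_cons_le {n : ℕ} {F : (Fin (n + 1) → ℝ) → ℝ} (hF : ∀ y, 0 ≤ F y)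
    (hc : ConvexOn ℝ Set.univ F) (z w : ℝ) {s : ℝ} (hs0 : 0 ≤ s) (hs1 : s ≤ 1) (x : Fin n → ℝ) :
    infConv F (Fin.cons z x) ≤ (1 - s) * infConv (fun y => F (Fin.cons z y)) x
      + s * infConv (fun y => F (Fin.cons w y)) x + (s * (z - w)) ^ 2 / 4 := by
  refine le_of_forall_pos_le_add fun η hη => ?_
  obtain ⟨y₀, h0⟩ := exists_lt_of_ciInf_lt
    (lt_add_of_pos_right (infConv (fun y => F (Fin.cons z y)) x) hη)
  obtain ⟨y₁, h1⟩ := exists_lt_of_ciInf_lt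
    (lt_add_of_pos_right (infConv (fun y => F (Fin.cons w y)) x) hη)
  have hs1' : 0 ≤ 1 - s := by linarith
  have h2 := infConv_le hF (Fin.cons z x)
    ((1 - s) • (Fin.cons z y₀ : Fin (n + 1) → ℝ) + s • (Fin.cons w y₁ : Fin (n + 1) → ℝ))
  have h3 := hc.2 (Set.mem_univ (Fin.cons z y₀)) (Set.mem_univ (Fin.cons w y₁)) hs1' hs0 (by ring)
  simp only [smul_eq_mul] at h3
  have h4 : ∑ i, ((Fin.cons z x : Fin (n + 1) → ℝ) i - ((1 - s) • (Fin.cons z y₀ : Fin (n + 1) → ℝ)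
      + s • (Fin.cons w y₁ : Fin (n + 1) → ℝ)) i) ^ 2
      ≤ (s * (z - w)) ^ 2 + ((1 - s) * ∑ i, (x i - y₀ i) ^ 2 + s * ∑ i, (x i - y₁ i) ^ 2) := by
    rw [Fin.sum_univ_succ]
    simp only [Pi.add_apply, Pi.smul_apply, Fin.cons_zero, Fin.cons_succ, smul_eq_mul]
    rw [Finset.mul_sum, Finset.mul_sum, ← Finset.sum_add_distrib]
    refine add_le_add (le_of_eq (by ring)) (Finset.sum_le_sum fun i _ => ?_)
    nlinarith [mul_nonneg (mul_nonneg hs0 hs1') (sq_nonneg (y₀ i - y₁ i))]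
  have h5 := mul_le_mul_of_nonneg_left h0.le hs1'
  have h6 := mul_le_mul_of_nonneg_left h1.le hs0
  nlinarith

/-- Maurey's inequality (the convex property `(τ)`) for products of Bernoulli distributions. -/
theorem maurey {n : ℕ} {p : Fin n → ℝ} (hp : ∀ i, 0 ≤ p i ∧ p i ≤ 1) {F : (Fin n → ℝ) → ℝ}
    (hF : ∀ y, 0 ≤ F y) (hc : ConvexOn ℝ Set.univ F) :
    bernExp p (fun x => Real.exp (infConv F x)) * bernExp p (fun x => Real.exp (-F x)) ≤ 1 := by
  induction n with
  | zero =>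
    have h0 : ∀ x, infConv F x ≤ F x := fun x => by simpa using infConv_le hF x x
    simp only [bernExp, Finset.univ_unique, Finset.univ_eq_empty, Finset.prod_empty, one_mul,
      Finset.sum_singleton]
    rw [← Real.exp_add, Real.exp_le_one_iff, ← sub_eq_add_neg, sub_nonpos]
    exact h0 _
  | succ n ih =>
    have hp' : ∀ i, 0 ≤ Fin.tail p i ∧ Fin.tail p i ≤ 1 := fun i => hp i.succ
    obtain ⟨hq0, hq1⟩ := hp 0
    set q := p 0
    set B : ℝ → ℝ := fun z => bernExp (Fin.tail p)
      (fun x => Real.exp (infConv (fun y => F (Fin.cons z y)) x)) with hB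
    set A : ℝ → ℝ := fun z => bernExp (Fin.tail p) (fun x => Real.exp (-F (Fin.cons z x))) with hA
    set X : ℝ → ℝ := fun z => bernExp (Fin.tail p) (fun x => Real.exp (infConv F (Fin.cons z x)))
      with hX
    have hApos : ∀ z, 0 < A z := fun z => bernExp_pos hp' fun x => Real.exp_pos _
    have hBpos : ∀ z, 0 < B z := fun z => bernExp_pos hp' fun x => Real.exp_pos _
    have hBA : ∀ z, B z * A z ≤ 1 := by
      intro z
      refine ih hp' (fun y => hF _) ⟨convex_univ, fun x _ y _ a b ha hb hab => ?_⟩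
      have := hc.2 (Set.mem_univ (Fin.cons z x)) (Set.mem_univ (Fin.cons z y)) ha hb hab
      convert this using 2
      funext i
      refine Fin.cases ?_ (fun j => ?_) i
      · simp [← add_mul, hab]
      · simp
    have hlog : ∀ z, Real.log (B z) ≤ -Real.log (A z) := by
      intro z
      have := Real.log_le_log (mul_pos (hBpos z) (hApos z)) (hBA z)
      rw [Real.log_mul (hBpos z).ne' (hApos z).ne', Real.log_one] at this
      linarith
    -- Hölder's inequality, in the form of the convexity of `exp`
    have hXs : ∀ z w : ℝ, (z - w) ^ 2 = 1 → ∀ s : ℝ, 0 ≤ s → s ≤ 1 →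
        X z ≤ Real.exp (s ^ 2 / 4 + (1 - s) * (-Real.log (A z)) + s * (-Real.log (A w))) := by
      intro z w hzw s hs0 hs1
      have hs1' : 0 ≤ 1 - s := by linarith
      set K := Real.exp (s ^ 2 / 4 + (1 - s) * Real.log (B z) + s * Real.log (B w)) with hK
      have hpt : ∀ x : Fin n → ℝ, Real.exp (infConv F (Fin.cons z x)) ≤
          (K * (1 - s) / B z) * Real.exp (infConv (fun y => F (Fin.cons z y)) x) +
          (K * s / B w) * Real.exp (infConv (fun y => F (Fin.cons w y)) x) := by
        intro x
        have h1 := infConv_cons_le hF hc z w hs0 hs1 x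
        rw [mul_pow, hzw, mul_one] at h1
        set u := infConv (fun y => F (Fin.cons z y)) x
        set v := infConv (fun y => F (Fin.cons w y)) x
        have h2 := convexOn_exp.2 (Set.mem_univ (u - Real.log (B z)))
          (Set.mem_univ (v - Real.log (B w))) hs1' hs0 (by ring)
        simp only [smul_eq_mul] at h2
        rw [Real.exp_sub, Real.exp_sub, Real.exp_log (hBpos z), Real.exp_log (hBpos w)] at h2
        calc Real.exp (infConv F (Fin.cons z x))
            ≤ Real.exp ((1 - s) * u + s * v + s ^ 2 / 4) := Real.exp_le_exp.2 h1
          _ = K * Real.exp ((1 - s) * (u - Real.log (B z)) + s * (v - Real.log (B w))) := by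
              rw [hK, ← Real.exp_add]; congr 1; ring
          _ ≤ K * ((1 - s) * (Real.exp u / B z) + s * (Real.exp v / B w)) :=
              mul_le_mul_of_nonneg_left h2 (Real.exp_pos _).le
          _ = _ := by ring
      have h3 := bernExp_mono hp' hpt
      rw [bernExp_linear] at h3
      change X z ≤ K * (1 - s) / B z * B z + K * s / B w * B w at h3
      rw [div_mul_cancel₀ _ (hBpos z).ne', div_mul_cancel₀ _ (hBpos w).ne'] at h3
      refine (h3.trans (le_of_eq (by ring : _ = K))).trans (Real.exp_le_exp.2 ?_)
      have := mul_le_mul_of_nonneg_left (hlog z) hs1'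
      have := mul_le_mul_of_nonneg_left (hlog w) hs0
      linarith
    have hX0 : ∀ z w : ℝ, (z - w) ^ 2 = 1 → X z ≤ Real.exp (-Real.log (A z)) := fun z w h => by
      simpa using hXs z w h 0 le_rfl zero_le_one
    have hAe : ∀ z, A z = Real.exp (- -Real.log (A z)) := fun z => by
      rw [neg_neg, Real.exp_log (hApos z)]
    rw [bernExp_succ, bernExp_succ]
    change ((1 - q) * X 0 + q * X 1) * ((1 - q) * A 0 + q * A 1) ≤ 1
    rw [hAe 0, hAe 1]
    rcases le_total (-Real.log (A 0)) (-Real.log (A 1)) with h | h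
    · exact two_point_maurey hq0 hq1 h (hX0 0 1 (by norm_num)) (hXs 1 0 (by norm_num))
    · have := two_point_maurey (q := 1 - q) (by linarith) (by linarith) h
        (hX0 1 0 (by norm_num)) (hXs 0 1 (by norm_num))
      refine le_trans (le_of_eq ?_) this
      ring

/-! ### Concentration and moments for independent binary variables -/

/-- Binary variables take finitely many values, so that every function of them factors through a
measurable map into a finite type. -/
lemma comp_binary_eq {Ω : Type*} {n : ℕ} {Y : Fin n → Ω → ℝ}
    (h01 : ∀ i ω, Y i ω = 0 ∨ Y i ω = 1) {β : Type*} (h : (Fin n → ℝ) → β) :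
    (fun ω => h fun i => Y i ω) = (fun x : Fin n → Bool => h fun i => if x i then 1 else 0) ∘
      fun ω i => decide (Y i ω = 1) := by
  funext ω
  simp only [Function.comp]
  congr 1
  funext i
  rcases h01 i ω with h | h <;> simp [h]

lemma one_add_sq_div_two_le_cosh (x : ℝ) : 1 + x ^ 2 / 2 ≤ Real.cosh x := by
  have h := sum_le_hasSum (Finset.range 2) (fun i _ => by rw [pow_mul]; positivity)
    (Real.hasSum_cosh x)
  simpa [Finset.sum_range_succ] using h

lemma pow_ten_div_factorial_le_cosh (x : ℝ) : x ^ 10 / 3628800 ≤ Real.cosh x := by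
  have h := sum_le_hasSum {5} (fun i _ => by rw [pow_mul]; positivity) (Real.hasSum_cosh x)
  simpa [Nat.factorial] using h

section Binary

variable {Ω : Type*} [MeasurableSpace Ω] {P : Measure Ω} [IsProbabilityMeasure P] {n : ℕ}
  {Y : Fin n → Ω → ℝ}

lemma measurable_decide_eq_one (hm : ∀ i, Measurable (Y i)) :
    Measurable fun ω (i : Fin n) => decide (Y i ω = 1) :=
  measurable_pi_lambda _ fun i => by
    refine measurable_to_bool ?_
    have : (fun ω => decide (Y i ω = 1)) ⁻¹' {true} = Y i ⁻¹' {1} := by ext; simp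
    rw [this]
    exact hm i (measurableSet_singleton 1)

lemma measurable_comp_binary (hm : ∀ i, Measurable (Y i)) (h01 : ∀ i ω, Y i ω = 0 ∨ Y i ω = 1)
    {β : Type*} [MeasurableSpace β] (h : (Fin n → ℝ) → β) :
    Measurable fun ω => h fun i => Y i ω := by
  rw [comp_binary_eq h01 h]
  exact (measurable_of_finite _).comp (measurable_decide_eq_one hm)

lemma integrable_comp_binary (hm : ∀ i, Measurable (Y i)) (h01 : ∀ i ω, Y i ω = 0 ∨ Y i ω = 1)
    (h : (Fin n → ℝ) → ℝ) : Integrable (fun ω => h fun i => Y i ω) P := by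
  rw [comp_binary_eq h01 h]
  have hξ := measurable_decide_eq_one hm
  have := Measure.isProbabilityMeasure_map (μ := P) hξ.aemeasurable
  refine Integrable.comp_measurable ?_ hξ
  exact Integrable.of_finite

lemma integrable_comp_noise (hm : ∀ i, Measurable (Y i)) (h01 : ∀ i ω, Y i ω = 0 ∨ Y i ω = 1)
    (h : (Fin n → ℝ) → ℝ) : Integrable (fun ω => h fun i => noise P Y i ω) P :=
  integrable_comp_binary hm h01 fun y => h fun i => y i - ∫ ω', Y i ω' ∂P

lemma exists_bernExp (hm : ∀ i, Measurable (Y i)) (h01 : ∀ i ω, Y i ω = 0 ∨ Y i ω = 1)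
    (hI : iIndepFun Y P) :
    ∃ p : Fin n → ℝ, (∀ i, 0 ≤ p i ∧ p i ≤ 1) ∧
      ∀ h : (Fin n → ℝ) → ℝ, ∫ ω, h (fun i => Y i ω) ∂P = bernExp p h := by
  refine ⟨fun i => P.real (Y i ⁻¹' {1}), fun i => ⟨measureReal_nonneg, measureReal_le_one⟩,
    fun h => ?_⟩
  have hξ := measurable_decide_eq_one hm
  have := Measure.isProbabilityMeasure_map (μ := P) hξ.aemeasurable
  rw [comp_binary_eq h01 h]
  have h1 := integral_map (μ := P) hξ.aemeasurable
    (f := fun x : Fin n → Bool => h fun i => if x i then 1 else 0)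
    (measurable_of_finite _).aestronglyMeasurable
  change ∫ ω, (fun x : Fin n → Bool => h fun i => if x i then 1 else 0)
    (fun i => decide (Y i ω = 1)) ∂P = _
  rw [← h1, integral_fintype Integrable.of_finite]
  unfold bernExp
  refine Finset.sum_congr rfl fun x _ => ?_
  rw [smul_eq_mul, map_measureReal_apply hξ (measurableSet_singleton x)]
  congr 1
  have h2 : (fun ω (i : Fin n) => decide (Y i ω = 1)) ⁻¹' {x}
      = ⋂ i ∈ Finset.univ, Y i ⁻¹' {if x i then (1 : ℝ) else 0} := by
    ext ω
    simp only [Set.mem_preimage, Set.mem_singleton_iff, Set.mem_iInter, Finset.mem_univ,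
      forall_const, funext_iff]
    refine forall_congr' fun i => ?_
    rcases h01 i ω with h | h <;> cases hx : x i <;> simp [h]
  rw [h2, measureReal_def, hI.measure_inter_preimage_eq_mul Finset.univ
    (fun i _ => measurableSet_singleton _), ENNReal.toReal_prod]
  refine Finset.prod_congr rfl fun i _ => ?_
  rw [← measureReal_def]
  cases hx : x i
  · have : Y i ⁻¹' {0} = (Y i ⁻¹' {1})ᶜ := by
      ext ω
      rcases h01 i ω with h | h <;> simp [h]
    simp [this, probReal_compl_eq_one_sub (hm i (measurableSet_singleton 1))]
  · simp

/-- Upper-tail concentration of a convex Lipschitz function of independent binary variables, with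
respect to the Euclidean norm: Maurey's inequality for `√t • V`, followed by Jensen's and Markov's
inequalities. -/
theorem convex_lipschitz_concentration (hm : ∀ i, Measurable (Y i))
    (h01 : ∀ i ω, Y i ω = 0 ∨ Y i ω = 1) (hI : iIndepFun Y P) {V : (Fin n → ℝ) → ℝ}
    (hV : ∀ y, 0 ≤ V y) (hc : ConvexOn ℝ Set.univ V)
    (hL : ∀ x y, V x ≤ V y + √(∑ i, (x i - y i) ^ 2)) {t : ℝ} (ht : 0 < t) :
    1 - Real.exp (-t) ≤
      P.real {ω | V (fun i => Y i ω) ≤ (∫ ω', V (fun i => Y i ω') ∂P) + 2 * √t} := by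
  obtain ⟨p, hp, hE⟩ := exists_bernExp hm h01 hI
  set θ := √t with hθ
  have hθ0 : 0 < θ := Real.sqrt_pos.2 ht
  have hθ2 : θ ^ 2 = t := Real.sq_sqrt ht.le
  set EV := ∫ ω', V (fun i => Y i ω') ∂P with hEV
  have h1 := maurey hp (F := fun y => θ * V y) (fun y => mul_nonneg hθ0.le (hV y))
    (hc.smul hθ0.le)
  have h2 : ∀ x : Fin n → ℝ, θ * V x - θ ^ 2 ≤ infConv (fun y => θ * V y) x := by
    intro x
    refine le_ciInf fun y => ?_
    have h3 := mul_le_mul_of_nonneg_left (hL x y) hθ0.le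
    have h4 : √(∑ i, (x i - y i) ^ 2) ^ 2 = ∑ i, (x i - y i) ^ 2 :=
      Real.sq_sqrt (Finset.sum_nonneg fun i _ => sq_nonneg _)
    rw [← h4]
    nlinarith [sq_nonneg (√(∑ i, (x i - y i) ^ 2) / 2 - θ)]
  have h3 := bernExp_mono hp fun x => Real.exp_le_exp.2 (h2 x)
  have h4 : Real.exp (-(θ * EV)) ≤ bernExp p fun x => Real.exp (-(θ * V x)) := by
    rw [← hE]
    have hi := integrable_comp_binary (P := P) hm h01 fun y => -(θ * V y)
    have hj := convexOn_exp.map_integral_le (μ := P) (f := fun ω => -(θ * V fun i => Y i ω))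
      Real.continuous_exp.continuousOn isClosed_univ (by simp) hi
      (integrable_comp_binary (P := P) hm h01 fun y => Real.exp (-(θ * V y)))
    rwa [integral_neg, integral_const_mul] at hj
  have h5 : bernExp p (fun x => Real.exp (θ * V x)) ≤ Real.exp (θ ^ 2 + θ * EV) := by
    have h6 : (fun x : Fin n → ℝ => Real.exp (θ * V x - θ ^ 2))
        = fun x => Real.exp (-θ ^ 2) * Real.exp (θ * V x) := by
      funext x; rw [← Real.exp_add]; congr 1; ring
    rw [h6, bernExp_const_mul] at h3
    set b := bernExp p (fun x => Real.exp (θ * V x)) with hb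
    have hb0 : 0 < b := bernExp_pos hp fun x => Real.exp_pos _
    have h7 : Real.exp (-θ ^ 2) * b * Real.exp (-(θ * EV)) ≤ 1 :=
      (mul_le_mul h3 h4 (Real.exp_pos _).le (bernExp_pos hp fun x => Real.exp_pos _).le).trans h1
    have h8 : b = Real.exp (θ ^ 2 + θ * EV) * (Real.exp (-θ ^ 2) * b * Real.exp (-(θ * EV))) := by
      rw [mul_right_comm (Real.exp (-θ ^ 2)), ← Real.exp_add, ← mul_assoc, ← Real.exp_add]
      ring_nf; simp
    rw [h8]
    exact (mul_le_mul_of_nonneg_left h7 (Real.exp_pos _).le).trans (le_of_eq (mul_one _))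
  have h9 := measure_ge_le_exp_mul_mgf (μ := P) (X := fun ω => V fun i => Y i ω) (EV + 2 * θ)
    hθ0.le (integrable_comp_binary (P := P) hm h01 fun y => Real.exp (θ * V y))
  rw [mgf, hE (fun x => Real.exp (θ * V x))] at h9
  have h10 : P.real {ω | EV + 2 * θ ≤ V fun i => Y i ω} ≤ Real.exp (-t) := by
    refine h9.trans ((mul_le_mul_of_nonneg_left h5 (Real.exp_pos _).le).trans (le_of_eq ?_))
    rw [← Real.exp_add, ← hθ2]; congr 1; ring
  have h11 : MeasurableSet {ω | V (fun i => Y i ω) ≤ EV + 2 * θ} :=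
    measurableSet_le (measurable_comp_binary hm h01 V) measurable_const
  have h12 := probReal_compl_eq_one_sub (μ := P) h11
  have h13 : P.real {ω | V (fun i => Y i ω) ≤ EV + 2 * θ}ᶜ ≤
      P.real {ω | EV + 2 * θ ≤ V fun i => Y i ω} :=
    measureReal_mono fun ω hω => (lt_of_not_ge hω : EV + 2 * θ < _).le
  linarith

lemma integral_cosh_noise_le (hm : ∀ i, Measurable (Y i))
    (h01 : ∀ i ω, Y i ω = 0 ∨ Y i ω = 1) (hI : iIndepFun Y P) {h : Fin n → ℝ}
    (hh : ∑ i, h i ^ 2 ≤ 1) (s : ℝ) :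
    ∫ ω, Real.cosh (s * ∑ i, h i * noise P Y i ω) ∂P ≤ Real.exp (s ^ 2 / 8) := by
  have hsub : HasSubgaussianMGF (fun ω => ∑ i, h i * noise P Y i ω)
      (∑ i, Real.toNNReal (h i ^ 2) / 4) P := by
    refine HasSubgaussianMGF.sum_of_iIndepFun ?_ fun i _ => ?_
    · exact hI.comp (fun i y => h i * (y - ∫ ω', Y i ω' ∂P)) fun i => by fun_prop
    · have h1 := (hasSubgaussianMGF_of_mem_Icc (μ := P) (a := 0) (b := 1) (hm i).aemeasurable
        (ae_of_all _ fun ω => by rcases h01 i ω with h | h <;> simp [h])).const_mul (h i)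
      change HasSubgaussianMGF (fun ω => h i * noise P Y i ω) _ P at h1
      convert h1 using 1
      apply NNReal.eq
      rw [NNReal.coe_div, Real.coe_toNNReal _ (sq_nonneg _)]
      change h i ^ 2 / (4 : ℝ) = h i ^ 2 * (‖(1 : ℝ) - 0‖ / 2) ^ 2
      norm_num
      ring
  have hb : ∀ r : ℝ, mgf (fun ω => ∑ i, h i * noise P Y i ω) P r ≤ Real.exp (r ^ 2 / 8) := by
    intro r
    refine (hsub.mgf_le r).trans (Real.exp_le_exp.2 ?_)
    push_cast
    simp only [Real.coe_toNNReal _ (sq_nonneg _)]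
    rw [← Finset.sum_div]
    nlinarith [mul_le_mul_of_nonneg_right hh (sq_nonneg r)]
  have hi : ∀ r : ℝ, Integrable (fun ω => Real.exp (r * ∑ i, h i * noise P Y i ω)) P := fun r =>
    integrable_comp_binary (P := P) hm h01
      fun y => Real.exp (r * ∑ i, h i * (y i - ∫ ω', Y i ω' ∂P))
  have h1 := hb s
  have h2 := hb (-s)
  simp only [mgf] at h1 h2
  simp only [Real.cosh_eq, ← neg_mul]
  rw [integral_div, integral_add (hi s) (hi (-s))]
  rw [neg_sq] at h2
  linarith

lemma integral_sq_noise_le (hm : ∀ i, Measurable (Y i))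
    (h01 : ∀ i ω, Y i ω = 0 ∨ Y i ω = 1) (hI : iIndepFun Y P) {h : Fin n → ℝ}
    (hh : ∑ i, h i ^ 2 ≤ 1) : ∫ ω, (∑ i, h i * noise P Y i ω) ^ 2 ∂P ≤ 0.27 := by
  have h1 := integral_cosh_noise_le hm h01 hI hh 1
  simp only [one_mul] at h1
  have hi : Integrable (fun ω => 2 * Real.cosh (∑ i, h i * noise P Y i ω)) P :=
    integrable_comp_noise hm h01 fun e => 2 * Real.cosh (∑ i, h i * e i)
  have h2 : ∫ ω, (∑ i, h i * noise P Y i ω) ^ 2 ∂P ≤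
      ∫ ω, (2 * Real.cosh (∑ i, h i * noise P Y i ω) - 2) ∂P := by
    refine integral_mono (integrable_comp_noise hm h01 fun e => (∑ i, h i * e i) ^ 2)
      (hi.sub (integrable_const 2)) fun ω => ?_
    have := one_add_sq_div_two_le_cosh (∑ i, h i * noise P Y i ω)
    dsimp only
    linarith
  rw [integral_sub hi (integrable_const _), integral_const_mul] at h2
  have h3 := Real.exp_bound' (x := 1 / 8) (by norm_num) (by norm_num) (n := 3) (by norm_num)
  norm_num [Finset.sum_range_succ, Nat.factorial] at h1 h2 h3 ⊢
  linarith

lemma integral_pow_ten_noise_le (hm : ∀ i, Measurable (Y i))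
    (h01 : ∀ i ω, Y i ω = 0 ∨ Y i ω = 1) (hI : iIndepFun Y P) {h : Fin n → ℝ}
    (hh : ∑ i, h i ^ 2 ≤ 1) : ∫ ω, (∑ i, h i * noise P Y i ω) ^ 10 ∂P ≤ 26 := by
  have h1 := integral_cosh_noise_le hm h01 hI hh 4
  have h2 : ∫ ω, (∑ i, h i * noise P Y i ω) ^ 10 ∂P ≤
      ∫ ω, 3628800 / 4 ^ 10 * Real.cosh (4 * ∑ i, h i * noise P Y i ω) ∂P := by
    refine integral_mono (integrable_comp_noise hm h01 fun e => (∑ i, h i * e i) ^ 10)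
      (integrable_comp_noise hm h01
        fun e => 3628800 / 4 ^ 10 * Real.cosh (4 * ∑ i, h i * e i)) fun ω => ?_
    have := pow_ten_div_factorial_le_cosh (4 * ∑ i, h i * noise P Y i ω)
    rw [mul_pow] at this
    dsimp only
    linarith
  rw [integral_const_mul] at h2
  have h3 : Real.exp (4 ^ 2 / 8) < 7.4 := by
    have h := Real.exp_one_lt_d9
    have h2 : Real.exp (4 ^ 2 / 8) = Real.exp 1 * Real.exp 1 := by
      rw [← Real.exp_add]; norm_num
    rw [h2]
    nlinarith [Real.exp_pos 1]
  norm_num at h2 h3 ⊢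
  norm_num at h1
  linarith

end Binary

/-! ### A truncated Haar expansion -/

/-- The length of the `a`-th dyadic block of level `m` inside `{0, …, c - 1}`; the blocks are
`{a 2ᵐ, …, (a + 1) 2ᵐ - 1}`, cut off at `c`. -/
def blockLen (c m a : ℕ) : ℕ := min ((a + 1) * 2 ^ m) c - min (a * 2 ^ m) c

/-- The sum of `f` over the `a`-th dyadic block of level `m` inside `{0, …, c - 1}`. -/
def blockSum (f : ℕ → ℝ) (c m a : ℕ) : ℝ :=
  ∑ i ∈ Finset.Ico (min (a * 2 ^ m) c) (min ((a + 1) * 2 ^ m) c), f i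

/-- The coefficient of `f` with respect to the (unbalanced) Haar vector that compares the blocks
`2 a` and `2 a + 1` of level `m`. It is `0` when the second block is empty. -/
noncomputable def haar (f : ℕ → ℝ) (c m a : ℕ) : ℝ :=
  √(((blockLen c m (2 * a) : ℝ) * blockLen c m (2 * a + 1)) /
      ((blockLen c m (2 * a) : ℝ) + blockLen c m (2 * a + 1))) *
    (blockSum f c m (2 * a) / blockLen c m (2 * a) -
      blockSum f c m (2 * a + 1) / blockLen c m (2 * a + 1))

lemma blockSum_eq_zero (f : ℕ → ℝ) {c m a : ℕ} (h : blockLen c m a = 0) : blockSum f c m a = 0 := by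
  unfold blockSum
  unfold blockLen at h
  rw [Finset.Ico_eq_empty (by omega), Finset.sum_empty]

lemma blockSum_eq_zero_of_le (f : ℕ → ℝ) {c m a : ℕ} (h : c ≤ a * 2 ^ m) :
    blockSum f c m a = 0 := by
  apply blockSum_eq_zero
  unfold blockLen
  omega

lemma two_mul_mul_two_pow (a m : ℕ) : 2 * a * 2 ^ m = a * 2 ^ (m + 1) := by ring

lemma two_mul_add_two_mul_two_pow (a m : ℕ) : (2 * a + 1 + 1) * 2 ^ m = (a + 1) * 2 ^ (m + 1) := by
  ring

lemma mul_two_pow_mono (a m : ℕ) : a * 2 ^ m ≤ (a + 1) * 2 ^ m :=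
  Nat.mul_le_mul_right _ (Nat.le_succ a)

lemma blockLen_succ (c m a : ℕ) :
    blockLen c (m + 1) a = blockLen c m (2 * a) + blockLen c m (2 * a + 1) := by
  have h1 := mul_two_pow_mono (2 * a) m
  have h2 := mul_two_pow_mono (2 * a + 1) m
  rw [two_mul_mul_two_pow] at h1
  rw [two_mul_add_two_mul_two_pow] at h2
  unfold blockLen
  rw [two_mul_mul_two_pow, two_mul_add_two_mul_two_pow]
  omega

lemma blockSum_succ (f : ℕ → ℝ) (c m a : ℕ) :
    blockSum f c (m + 1) a = blockSum f c m (2 * a) + blockSum f c m (2 * a + 1) := by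
  have h1 := mul_two_pow_mono (2 * a) m
  have h2 := mul_two_pow_mono (2 * a + 1) m
  rw [two_mul_mul_two_pow] at h1
  rw [two_mul_add_two_mul_two_pow] at h2
  unfold blockSum
  rw [two_mul_mul_two_pow, two_mul_add_two_mul_two_pow,
    Finset.sum_Ico_consecutive _ (by omega) (by omega)]

lemma blockLen_right_eq_zero {c m a : ℕ} (h : blockLen c m (2 * a) = 0) :
    blockLen c m (2 * a + 1) = 0 := by
  have h1 := mul_two_pow_mono (2 * a) m
  have h2 : 2 * a * 2 ^ m < (2 * a + 1) * 2 ^ m := by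
    rw [add_one_mul]; exact Nat.lt_add_of_pos_right (by positivity)
  unfold blockLen at *
  omega

lemma haar_mul_haar (e f : ℕ → ℝ) (c m a : ℕ) :
    blockSum e c m (2 * a) * blockSum f c m (2 * a) / blockLen c m (2 * a)
      + blockSum e c m (2 * a + 1) * blockSum f c m (2 * a + 1) / blockLen c m (2 * a + 1)
    = blockSum e c (m + 1) a * blockSum f c (m + 1) a / blockLen c (m + 1) a
      + haar e c m a * haar f c m a := by
  rw [blockSum_succ, blockSum_succ, blockLen_succ]
  unfold haar
  rw [mul_mul_mul_comm, Real.mul_self_sqrt (by positivity)]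
  push_cast
  by_cases hq : blockLen c m (2 * a + 1) = 0
  · simp [blockSum_eq_zero _ hq, hq]
  · have hp : blockLen c m (2 * a) ≠ 0 := fun h => hq (blockLen_right_eq_zero h)
    have hq' : (blockLen c m (2 * a + 1) : ℝ) ≠ 0 := Nat.cast_ne_zero.2 hq
    have hp' : (blockLen c m (2 * a) : ℝ) ≠ 0 := Nat.cast_ne_zero.2 hp
    have hpq : (blockLen c m (2 * a) : ℝ) + blockLen c m (2 * a + 1) ≠ 0 := by positivity
    field_simp
    ring

lemma sum_range_two_mul (g : ℕ → ℝ) (N : ℕ) :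
    ∑ a ∈ Finset.range (2 * N), g a = ∑ a ∈ Finset.range N, (g (2 * a) + g (2 * a + 1)) := by
  induction N with
  | zero => simp
  | succ N ih =>
    rw [Finset.sum_range_succ, ← ih, mul_add, mul_one, Finset.sum_range_succ, Finset.sum_range_succ]
    ring

/-- The Haar expansion of the scalar product on `{0, …, c - 1}`. -/
theorem sum_mul_eq_haar (e f : ℕ → ℝ) {c J : ℕ} (hJ : c ≤ 2 ^ J) :
    ∑ i ∈ Finset.range c, e i * f i =
      (∑ i ∈ Finset.range c, e i) * (∑ i ∈ Finset.range c, f i) / c +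
      ∑ m ∈ Finset.range J, ∑ a ∈ Finset.range c, haar e c m a * haar f c m a := by
  set L : ℕ → ℝ := fun m => ∑ a ∈ Finset.range c,
    blockSum e c m a * blockSum f c m a / blockLen c m a with hL
  have h1 : ∀ m, L m = L (m + 1) + ∑ a ∈ Finset.range c, haar e c m a * haar f c m a := by
    intro m
    have h2 : L m = ∑ a ∈ Finset.range (2 * c),
        blockSum e c m a * blockSum f c m a / blockLen c m a := by
      refine Finset.sum_subset (Finset.range_mono (by omega)) fun a _ ha => ?_
      have ha' : c ≤ a := by simpa using ha
      rw [blockSum_eq_zero_of_le e (ha'.trans (Nat.le_mul_of_pos_right a (by positivity)))]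
      simp
    rw [h2, sum_range_two_mul, ← Finset.sum_add_distrib]
    exact Finset.sum_congr rfl fun a _ => haar_mul_haar e f c m a
  have h3 : L 0 - L J =
      ∑ m ∈ Finset.range J, ∑ a ∈ Finset.range c, haar e c m a * haar f c m a := by
    rw [← Finset.sum_range_sub']
    exact Finset.sum_congr rfl fun m _ => by rw [h1 m]; ring
  have h4 : L 0 = ∑ i ∈ Finset.range c, e i * f i := by
    refine Finset.sum_congr rfl fun a ha => ?_
    have ha' : a < c := Finset.mem_range.1 ha
    have e1 : min (a * 2 ^ 0) c = a := by simp; omega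
    have e2 : min ((a + 1) * 2 ^ 0) c = a + 1 := by simp; omega
    simp only [blockSum, blockLen]
    rw [e1, e2]
    simp
  have h5 : L J = (∑ i ∈ Finset.range c, e i) * (∑ i ∈ Finset.range c, f i) / c := by
    rcases Nat.eq_zero_or_pos c with rfl | hc
    · simp [hL]
    · rw [hL]
      refine (Finset.sum_eq_single_of_mem (0 : ℕ) (Finset.mem_range.2 hc) ?_).trans ?_
      · intro a _ ha
        rw [blockSum_eq_zero_of_le e (hJ.trans (Nat.le_mul_of_pos_left _ (Nat.pos_of_ne_zero ha)))]
        simp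
      · have e1 : min (0 * 2 ^ J) c = 0 := by simp
        have e2 : min ((0 + 1) * 2 ^ J) c = c := by rw [zero_add, one_mul]; omega
        simp only [blockSum, blockLen]
        rw [e1, e2, Finset.range_eq_Ico, Nat.sub_zero]
  linarith

lemma sq_sum_div_le (f : ℕ → ℝ) (c : ℕ) :
    (∑ i ∈ Finset.range c, f i) ^ 2 / c ≤ ∑ i ∈ Finset.range c, f i ^ 2 := by
  have h := sum_mul_eq_haar f f (Nat.lt_two_pow_self (n := c)).le
  simp only [← sq] at h
  rw [h]
  have : 0 ≤ ∑ m ∈ Finset.range c, ∑ a ∈ Finset.range c, haar f c m a ^ 2 :=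
    Finset.sum_nonneg fun m _ => Finset.sum_nonneg fun a _ => sq_nonneg _
  linarith

lemma sq_haar_le (f : ℕ → ℝ) {c m a : ℕ} : haar f c m a ^ 2 ≤ ∑ i ∈ Finset.range c, f i ^ 2 := by
  by_cases ha : a < c
  · have hJ : c ≤ 2 ^ max c (m + 1) :=
      (Nat.lt_two_pow_self (n := c)).le.trans (Nat.pow_le_pow_right (by norm_num) (le_max_left _ _))
    have h := sum_mul_eq_haar f f hJ
    simp only [← sq] at h
    rw [h]
    have h1 : haar f c m a ^ 2 ≤
        ∑ m ∈ Finset.range (max c (m + 1)), ∑ a ∈ Finset.range c, haar f c m a ^ 2 :=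
      (Finset.single_le_sum (f := fun a => haar f c m a ^ 2) (fun _ _ => sq_nonneg _)
        (Finset.mem_range.2 ha)).trans
      (Finset.single_le_sum (f := fun m => ∑ a ∈ Finset.range c, haar f c m a ^ 2)
        (fun _ _ => Finset.sum_nonneg fun _ _ => sq_nonneg _)
        (Finset.mem_range.2 (lt_of_lt_of_le (Nat.lt_succ_self m) (le_max_right _ _))))
    have : 0 ≤ (∑ i ∈ Finset.range c, f i) ^ 2 / c := by positivity
    linarith
  · have h1 : c ≤ a * 2 ^ (m + 1) := (not_lt.1 ha).trans (Nat.le_mul_of_pos_right a (by positivity))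
    have h2 : blockLen c m (2 * a) = 0 := by
      unfold blockLen; rw [two_mul_mul_two_pow]; omega
    simp only [haar, h2]
    simp
    positivity

lemma sum_Ico_eq_right (f : ℕ → ℝ) {l M : ℕ} (h : l ≤ M) :
    ∑ i ∈ Finset.Ico l M, f i =
      ((M : ℝ) - l) * f M - ∑ t ∈ Finset.Ioc l M, ((t : ℝ) - l) * (f t - f (t - 1)) := by
  induction M, h using Nat.le_induction with
  | base => simp
  | succ M hM ih =>
    rw [Finset.sum_Ico_succ_top hM, ih, ← Finset.insert_Ioc_right_eq_Ioc_add_one hM,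
      Finset.sum_insert (by simp)]
    push_cast
    ring

lemma sum_Ioc_sub (f : ℕ → ℝ) {M r : ℕ} (h : M ≤ r) :
    ∑ t ∈ Finset.Ioc M r, (f t - f (t - 1)) = f r - f M := by
  induction r, h using Nat.le_induction with
  | base => simp
  | succ r hr ih =>
    rw [← Finset.insert_Ioc_right_eq_Ioc_add_one hr, Finset.sum_insert (by simp), ih]
    simp

lemma sum_Ico_eq_left (f : ℕ → ℝ) {M r : ℕ} (h : M ≤ r) :
    ∑ i ∈ Finset.Ico M (r + 1), f i =
      ((r : ℝ) + 1 - M) * f M + ∑ t ∈ Finset.Ioc M r, ((r : ℝ) + 1 - t) * (f t - f (t - 1)) := by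
  induction r, h using Nat.le_induction with
  | base => simp
  | succ r hr ih =>
    have h1 := sum_Ioc_sub f hr
    rw [Finset.sum_Ico_succ_top (by omega), ih, ← Finset.insert_Ioc_right_eq_Ioc_add_one hr,
      Finset.sum_insert (by simp)]
    have h2 : ∑ t ∈ Finset.Ioc M r, (((r + 1 : ℕ) : ℝ) + 1 - t) * (f t - f (t - 1))
        = ∑ t ∈ Finset.Ioc M r, ((r : ℝ) + 1 - t) * (f t - f (t - 1)) + (f r - f M) := by
      rw [← h1, ← Finset.sum_add_distrib]
      refine Finset.sum_congr rfl fun t _ => ?_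
      push_cast; ring
    rw [h2]
    push_cast
    ring

/-- A bound for the primitive, at the cut between `t - 1` and `t`, of the Haar vectors of level
`m`, whose supports have length at most `2 ^ (m + 1)`. The two cases distinguish whether or not the
support may start at `0`. -/
noncomputable def haarKernel (m t : ℕ) : ℝ :=
  if 2 ^ (m + 1) ≤ t then √(2 ^ (m + 1)) / 2 else t / √(2 ^ (m + 1))

lemma haarKernel_nonneg (m t : ℕ) : 0 ≤ haarKernel m t := by
  unfold haarKernel; split_ifs <;> positivity

/-- Haar coefficients are controlled by the increments of the vector. -/
lemma abs_haar_le (f : ℕ → ℝ) (c m a : ℕ) :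
    |haar f c m a| ≤ ∑ t ∈ Finset.Ioo (a * 2 ^ (m + 1)) (min ((a + 1) * 2 ^ (m + 1)) c),
      haarKernel m t * |f t - f (t - 1)| := by
  by_cases hq : blockLen c m (2 * a + 1) = 0
  · simp only [haar, hq]
    simp only [Nat.cast_zero, mul_zero, zero_div, Real.sqrt_zero, zero_mul, abs_zero]
    exact Finset.sum_nonneg fun t _ => mul_nonneg (haarKernel_nonneg _ _) (abs_nonneg _)
  set l := a * 2 ^ (m + 1) with hl
  set M := (2 * a + 1) * 2 ^ m with hM
  have hlM : M = l + 2 ^ m := by rw [hM, hl]; ring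
  have hR : (a + 1) * 2 ^ (m + 1) = M + 2 ^ m := by rw [hM]; ring
  have hpow : 1 ≤ 2 ^ m := Nat.one_le_two_pow
  have hqd : blockLen c m (2 * a + 1) = min (M + 2 ^ m) c - min M c := by
    unfold blockLen; rw [two_mul_add_two_mul_two_pow, hR]
  have hMc : M < c := by omega
  obtain ⟨r, hr⟩ : ∃ r, min (M + 2 ^ m) c = r + 1 := ⟨min (M + 2 ^ m) c - 1, by omega⟩
  have hMr : M ≤ r := by omega
  have hq1 : (blockLen c m (2 * a + 1) : ℝ) = r + 1 - M := by
    have : blockLen c m (2 * a + 1) + M = r + 1 := by omega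
    have : ((blockLen c m (2 * a + 1) + M : ℕ) : ℝ) = ((r + 1 : ℕ) : ℝ) := by rw [this]
    push_cast at this; linarith
  have hp1 : (blockLen c m (2 * a) : ℝ) = 2 ^ m := by
    have : blockLen c m (2 * a) = 2 ^ m := by
      unfold blockLen; rw [two_mul_mul_two_pow, ← hl, ← hM]; omega
    rw [this]; push_cast; rfl
  have hbL : blockSum f c m (2 * a) = ∑ i ∈ Finset.Ico l M, f i := by
    unfold blockSum
    rw [two_mul_mul_two_pow, ← hl, ← hM, min_eq_left (by omega), min_eq_left (by omega)]
  have hbR : blockSum f c m (2 * a + 1) = ∑ i ∈ Finset.Ico M (r + 1), f i := by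
    unfold blockSum
    rw [two_mul_add_two_mul_two_pow, hR, ← hM, hr, min_eq_left (by omega)]
  have hlMr : (M : ℝ) = l + 2 ^ m := by rw [hlM]; push_cast; rfl
  have hrM : (r : ℝ) + 1 ≤ M + 2 ^ m := by
    have : r + 1 ≤ M + 2 ^ m := by omega
    exact_mod_cast this
  have hMr' : (M : ℝ) ≤ r := by exact_mod_cast hMr
  rw [hR, hr]
  unfold haar
  rw [hq1, hp1, hbL, hbR, sum_Ico_eq_right f (show l ≤ M by omega), sum_Ico_eq_left f hMr]
  set p : ℝ := 2 ^ m with hp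
  have hp0 : 0 < p := by positivity
  set q : ℝ := r + 1 - M with hqq
  have hq0 : 0 < q := by linarith
  have hqp : q ≤ p := by linarith
  have hg : (2 : ℝ) ^ (m + 1) = 2 * p := by rw [pow_succ]; ring
  have hσ : √(p * q / (p + q)) ≤ √(2 * p) / 2 := by
    rw [show √(2 * p) / 2 = √(2 * p / 4) by
      rw [Real.sqrt_div' _ (by norm_num), show (4 : ℝ) = 2 ^ 2 by norm_num,
        Real.sqrt_sq (by norm_num)]]
    apply Real.sqrt_le_sqrt
    rw [div_le_iff₀ (by positivity)]
    nlinarith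
  set σ := √(p * q / (p + q)) with hσd
  have hσ0 : 0 ≤ σ := Real.sqrt_nonneg _
  have hML : (M : ℝ) - l = p := by linarith
  have e1 : (((M : ℝ) - l) * f M - ∑ t ∈ Finset.Ioc l M, ((t : ℝ) - l) * (f t - f (t - 1))) / p -
      (q * f M + ∑ t ∈ Finset.Ioc M r, ((r : ℝ) + 1 - t) * (f t - f (t - 1))) / q
      = -(∑ t ∈ Finset.Ioc l M, (((t : ℝ) - l) / p) * (f t - f (t - 1)) +
        ∑ t ∈ Finset.Ioc M r, (((r : ℝ) + 1 - t) / q) * (f t - f (t - 1))) := by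
    rw [hML, sub_div, add_div, mul_div_cancel_left₀ _ hp0.ne', mul_div_cancel_left₀ _ hq0.ne',
      Finset.sum_div, Finset.sum_div]
    simp only [div_mul_eq_mul_div]
    ring
  rw [e1, abs_mul, abs_neg, abs_of_nonneg hσ0]
  have hset : Finset.Ioo l (r + 1) = Finset.Ioc l M ∪ Finset.Ioc M r := by
    ext t; simp only [Finset.mem_Ioo, Finset.mem_union, Finset.mem_Ioc]; omega
  have hdis : Disjoint (Finset.Ioc l M) (Finset.Ioc M r) := by
    rw [Finset.disjoint_left]; intro t; simp only [Finset.mem_Ioc]; omega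
  rw [hset, Finset.sum_union hdis]
  refine (mul_le_mul_of_nonneg_left ((abs_add_le _ _).trans (add_le_add
    (Finset.abs_sum_le_sum_abs _ _) (Finset.abs_sum_le_sum_abs _ _))) hσ0).trans ?_
  rw [mul_add, Finset.mul_sum, Finset.mul_sum]
  have hcast : ∀ t : ℕ, (2 ^ (m + 1) ≤ t ↔ 2 * p ≤ (t : ℝ)) := by
    intro t; rw [← hg]; norm_cast
  -- If the support reaches below `2 ^ (m + 1)`, it starts at `0`.
  have hl0 : ∀ t : ℕ, l < t → ¬ 2 ^ (m + 1) ≤ t → l = 0 := by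
    intro t h1 h2
    rcases Nat.eq_zero_or_pos a with h | h
    · rw [hl, h, zero_mul]
    · have : 2 ^ (m + 1) ≤ l := Nat.le_mul_of_pos_left _ h
      omega
  have hsq : √(2 * p) * √(2 * p) = 2 * p := Real.mul_self_sqrt (by positivity)
  have hs0 : 0 < √(2 * p) := Real.sqrt_pos.2 (by positivity)
  refine add_le_add (Finset.sum_le_sum fun t ht => ?_) (Finset.sum_le_sum fun t ht => ?_)
  all_goals
    rw [Finset.mem_Ioc] at ht
    rw [abs_mul, ← mul_assoc]
    refine mul_le_mul_of_nonneg_right ?_ (abs_nonneg _)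
  · have h1 : (l : ℝ) < t := by exact_mod_cast ht.1
    have h2 : (t : ℝ) ≤ M := by exact_mod_cast ht.2
    rw [abs_of_nonneg (div_nonneg (by linarith) hp0.le)]
    unfold haarKernel
    rw [hg]
    split_ifs with hc
    · refine le_trans ?_ hσ
      exact mul_le_of_le_one_right hσ0 ((div_le_one hp0).2 (by linarith))
    · have h3 : (l : ℝ) = 0 := by exact_mod_cast hl0 t ht.1 hc
      rw [h3, sub_zero, le_div_iff₀ hs0]
      have : σ * (t / p) * √(2 * p) = (σ * √(2 * p)) * (t / p) := by ring
      rw [this]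
      have h4 : σ * √(2 * p) ≤ p :=
        (mul_le_mul_of_nonneg_right hσ hs0.le).trans (by rw [div_mul_eq_mul_div, hsq]; linarith)
      calc σ * √(2 * p) * (t / p) ≤ p * (t / p) := by gcongr
        _ = t := by field_simp
  · have h1 : (M : ℝ) < t := by exact_mod_cast ht.1
    have h2 : (t : ℝ) ≤ r := by exact_mod_cast ht.2
    rw [abs_of_nonneg (div_nonneg (by linarith) hq0.le)]
    have h5 : σ * (((r : ℝ) + 1 - t) / q) ≤ √(2 * p) / 2 :=
      le_trans (mul_le_of_le_one_right hσ0 ((div_le_one hq0).2 (by linarith))) hσ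
    refine h5.trans ?_
    unfold haarKernel
    rw [hg]
    split_ifs with hc
    · exact le_rfl
    · have h3 : (l : ℝ) = 0 := by exact_mod_cast hl0 t (by omega) hc
      rw [le_div_iff₀ hs0, div_mul_eq_mul_div, hsq]
      linarith

/-! ### Thresholds -/

lemma sum_fourth_root_le (J : ℕ) (G : ℝ) :
    ∑ m ∈ Finset.range J with (2 : ℝ) ^ (m + 1) ≤ G, √√((2 : ℝ) ^ (m + 1)) ≤ 6.5 * √√G := by
  suffices h : ∑ m ∈ Finset.range J with (2 : ℝ) ^ (m + 1) ≤ G, √√((2 : ℝ) ^ (m + 1)) ≤ 6.5 * √√G ∧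
      ∑ m ∈ Finset.range J with (2 : ℝ) ^ (m + 1) ≤ G, √√((2 : ℝ) ^ (m + 1))
        ≤ 6.5 * √√((2 : ℝ) ^ J) from h.1
  have hρ : (1.182 : ℝ) ≤ √√2 := by
    apply Real.le_sqrt_of_sq_le
    apply Real.le_sqrt_of_sq_le
    norm_num
  induction J with
  | zero => constructor <;> simp <;> positivity
  | succ J ih =>
    have e : √√((2 : ℝ) ^ (J + 1)) = √√((2 : ℝ) ^ J) * √√2 := by
      rw [pow_succ, Real.sqrt_mul (by positivity), Real.sqrt_mul (by positivity)]
    have h0 : 0 ≤ √√((2 : ℝ) ^ J) := Real.sqrt_nonneg _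
    have h1 := mul_le_mul_of_nonneg_left hρ h0
    rw [Finset.range_add_one, Finset.filter_insert]
    split_ifs with hc
    · rw [Finset.sum_insert (by simp)]
      have h2 : √√((2 : ℝ) ^ (J + 1)) + ∑ m ∈ Finset.range J with (2 : ℝ) ^ (m + 1) ≤ G,
          √√((2 : ℝ) ^ (m + 1)) ≤ 6.5 * √√((2 : ℝ) ^ (J + 1)) := by
        have := ih.2
        rw [e]
        nlinarith
      refine ⟨h2.trans ?_, h2⟩
      gcongr
    · refine ⟨ih.1, ih.2.trans ?_⟩
      rw [e]
      nlinarith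

lemma sum_inv_sqrt_le (J : ℕ) {t : ℝ} (ht : 0 < t) :
    ∑ m ∈ Finset.range J with t < (2 : ℝ) ^ (m + 1), 1 / √((2 : ℝ) ^ (m + 1)) ≤ 3.5 / √t := by
  suffices h : (∑ m ∈ Finset.range J with t < (2 : ℝ) ^ (m + 1), 1 / √((2 : ℝ) ^ (m + 1)) ≤
        3.5 / √t - 2.45 * (1 / √((2 : ℝ) ^ J))) ∨
      ((2 : ℝ) ^ J ≤ t ∧
        ∑ m ∈ Finset.range J with t < (2 : ℝ) ^ (m + 1), 1 / √((2 : ℝ) ^ (m + 1)) = 0) by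
    rcases h with h | ⟨-, h⟩
    · have : 0 ≤ 1 / √((2 : ℝ) ^ J) := by positivity
      linarith
    · rw [h]; positivity
  have hσ : 1 / √2 ≤ (0.71 : ℝ) := by
    rw [div_le_iff₀ (by positivity)]
    have : (1.41 : ℝ) ≤ √2 := Real.le_sqrt_of_sq_le (by norm_num)
    linarith
  induction J with
  | zero =>
    by_cases h : (1 : ℝ) ≤ t
    · right; simpa using h
    · left
      have h1 : √t ≤ 1 := Real.sqrt_le_one.2 (by linarith)
      have h2 : 3.5 ≤ 3.5 / √t := by
        rw [le_div_iff₀ (Real.sqrt_pos.2 ht)]; linarith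
      norm_num at h2 ⊢
      linarith
  | succ J ih =>
    have e : 1 / √((2 : ℝ) ^ (J + 1)) = 1 / √((2 : ℝ) ^ J) * (1 / √2) := by
      rw [pow_succ, Real.sqrt_mul (by positivity), one_div_mul_one_div]
    have h0 : 0 ≤ 1 / √((2 : ℝ) ^ J) := by positivity
    have h1 := mul_le_mul_of_nonneg_left hσ h0
    rw [Finset.range_add_one, Finset.filter_insert]
    split_ifs with hc
    · rw [Finset.sum_insert (by simp)]
      left
      rcases ih with ih | ⟨-, ih⟩
      · rw [e]; linarith
      · rw [ih, add_zero]
        have : 1 / √((2 : ℝ) ^ (J + 1)) ≤ 1 / √t :=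
          one_div_le_one_div_of_le (Real.sqrt_pos.2 ht) (Real.sqrt_le_sqrt hc.le)
        have h3 : 3.5 / √t = 3.5 * (1 / √t) := by ring
        have h4 : 0 ≤ 1 / √t := by positivity
        linarith
    · right
      refine ⟨not_lt.1 hc, ?_⟩
      apply Finset.sum_eq_zero
      intro m hm
      rw [Finset.mem_filter, Finset.mem_range] at hm
      exfalso
      refine hc (hm.2.trans_le ?_)
      exact pow_le_pow_right₀ (by norm_num) (by omega)

/-- The threshold for the Haar coefficients of the `a`-th block of any level, when the increment at
distance `t` from the origin is penalized by `T √t`. Coefficients with `T² (1 + a) < 256` are not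
penalized; beyond, the fourth root is a compromise: it grows fast enough for the excesses over the
thresholds to be summable over `a`, and slowly enough for the thresholds to be summable over the
levels. -/
noncomputable def thr (T : ℝ) (a : ℕ) : ℝ :=
  if 256 ≤ T ^ 2 * (1 + a) then √(T * √(1 + a)) / 2 else 0

lemma thr_nonneg (T : ℝ) (a : ℕ) : 0 ≤ thr T a := by
  unfold thr; split_ifs <;> positivity

/-- The contributions of blocks that do not start at the origin. -/
lemma thr_mul_haarKernel_le_of_le {T : ℝ} (hT : 0 < T) {m t : ℕ} (h : 2 ^ (m + 1) ≤ t) :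
    thr T (t / 2 ^ (m + 1)) * haarKernel m t ≤
      if (2 : ℝ) ^ (m + 1) ≤ min (t : ℝ) (T ^ 2 * t / 128)
        then √T * √√(2 * t) / 4 * √√((2 : ℝ) ^ (m + 1)) else 0 := by
  have hg : (0 : ℝ) < 2 ^ (m + 1) := by positivity
  have h' : (2 : ℝ) ^ (m + 1) ≤ t := by exact_mod_cast h
  have ha : (1 : ℝ) + (t / 2 ^ (m + 1) : ℕ) ≤ 2 * t / 2 ^ (m + 1) := by
    have h1 : ((t / 2 ^ (m + 1) : ℕ) : ℝ) ≤ t / 2 ^ (m + 1) := by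
      refine Nat.cast_div_le.trans (le_of_eq ?_); push_cast; rfl
    have h2 : 1 ≤ (t : ℝ) / 2 ^ (m + 1) := (one_le_div hg).2 h'
    rw [mul_div_assoc]; linarith
  have hK : haarKernel m t = √(2 ^ (m + 1)) / 2 := if_pos h
  unfold thr
  by_cases hc : 256 ≤ T ^ 2 * (1 + ((t / 2 ^ (m + 1) : ℕ) : ℝ))
  · rw [if_pos hc, if_pos]
    · rw [hK]
      have h1 : √(T * √(1 + ((t / 2 ^ (m + 1) : ℕ) : ℝ))) ≤ √(T * √(2 * t / 2 ^ (m + 1))) := by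
        gcongr
      calc _ ≤ √(T * √(2 * t / 2 ^ (m + 1))) / 2 * (√(2 ^ (m + 1)) / 2) := by gcongr
        _ = √T * √√(2 * t) / 4 * √√((2 : ℝ) ^ (m + 1)) := by
          rw [Real.sqrt_mul hT.le, Real.sqrt_div' _ hg.le, Real.sqrt_div' _ (Real.sqrt_nonneg _)]
          have h3 : √√((2 : ℝ) ^ (m + 1)) * √√((2 : ℝ) ^ (m + 1)) = √((2 : ℝ) ^ (m + 1)) :=
            Real.mul_self_sqrt (Real.sqrt_nonneg _)
          have h4 : 0 < √√((2 : ℝ) ^ (m + 1)) := Real.sqrt_pos.2 (Real.sqrt_pos.2 hg)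
          field_simp
          linear_combination (-4) * √√(2 * (t : ℝ)) * h3
    · refine le_min h' ?_
      have h1 := hc.trans (mul_le_mul_of_nonneg_left ha (sq_nonneg T))
      rw [← mul_div_assoc, le_div_iff₀ hg] at h1
      linarith
  · rw [if_neg hc, zero_mul]
    split_ifs <;> positivity

/-- At every cut `t`, the thresholds of all levels together are at most the penalty. -/
lemma sum_thr_mul_haarKernel_le {T : ℝ} (hT : 0 < T) (J : ℕ) {t : ℕ} (ht : 1 ≤ t) :
    ∑ m ∈ Finset.range J, thr T (t / 2 ^ (m + 1)) * haarKernel m t ≤ T * √t := by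
  have ht0 : (0 : ℝ) < t := by exact_mod_cast ht
  have hst : √√(t : ℝ) * √√(t : ℝ) = √t := Real.mul_self_sqrt (Real.sqrt_nonneg _)
  have hsT : √T * √T = T := Real.mul_self_sqrt hT.le
  have hst0 : 0 < √√(t : ℝ) := Real.sqrt_pos.2 (Real.sqrt_pos.2 ht0)
  have hsT0 : 0 < √T := Real.sqrt_pos.2 hT
  have h2t : √√(2 * t : ℝ) = √√2 * √√(t : ℝ) := by
    rw [Real.sqrt_mul (by norm_num), Real.sqrt_mul (by positivity)]
  have hρ : √√2 ≤ (1.19 : ℝ) := by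
    rw [Real.sqrt_le_left (by norm_num), Real.sqrt_le_left (by norm_num)]; norm_num
  set G := min (t : ℝ) (T ^ 2 * t / 128) with hG
  have hG0 : 0 ≤ G := by positivity
  have hfar : ∑ m ∈ Finset.range J with 2 ^ (m + 1) ≤ t,
      thr T (t / 2 ^ (m + 1)) * haarKernel m t ≤ √T * √√(2 * t) / 4 * (6.5 * √√G) := by
    calc _ ≤ ∑ m ∈ Finset.range J with 2 ^ (m + 1) ≤ t, (if (2 : ℝ) ^ (m + 1) ≤ G
          then √T * √√(2 * t) / 4 * √√((2 : ℝ) ^ (m + 1)) else 0) :=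
          Finset.sum_le_sum fun m hm =>
            thr_mul_haarKernel_le_of_le hT (Finset.mem_filter.1 hm).2
      _ ≤ ∑ m ∈ Finset.range J, (if (2 : ℝ) ^ (m + 1) ≤ G
          then √T * √√(2 * t) / 4 * √√((2 : ℝ) ^ (m + 1)) else 0) := by
          refine Finset.sum_le_sum_of_subset_of_nonneg (Finset.filter_subset _ _) fun m _ _ => ?_
          split_ifs <;> positivity
      _ = √T * √√(2 * t) / 4 *
          ∑ m ∈ Finset.range J with (2 : ℝ) ^ (m + 1) ≤ G, √√((2 : ℝ) ^ (m + 1)) := by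
          rw [← Finset.sum_filter, Finset.mul_sum]
      _ ≤ _ := mul_le_mul_of_nonneg_left (sum_fourth_root_le J G) (by positivity)
  have hnear : ∀ m ∈ (Finset.range J).filter fun m => ¬ 2 ^ (m + 1) ≤ t,
      thr T (t / 2 ^ (m + 1)) * haarKernel m t =
        thr T 0 * t * (1 / √((2 : ℝ) ^ (m + 1))) := by
    intro m hm
    have h1 := (Finset.mem_filter.1 hm).2
    rw [Nat.div_eq_of_lt (not_le.1 h1), haarKernel, if_neg h1]
    ring
  rw [← Finset.sum_filter_add_sum_filter_not _ fun m => 2 ^ (m + 1) ≤ t,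
    Finset.sum_congr rfl hnear, ← Finset.mul_sum]
  by_cases hT16 : T < 16
  · have h0 : thr T 0 = 0 := by
      unfold thr
      rw [if_neg]
      push_cast
      nlinarith
    rw [h0, zero_mul, zero_mul, add_zero]
    refine hfar.trans ?_
    have h1 : √√G ≤ √T * √√(t : ℝ) / 3.36 := by
      have h2 : √√(T ^ 2 * t / 128) ≤ √T * √√(t : ℝ) / 3.36 := by
        rw [Real.sqrt_le_left (by positivity), Real.sqrt_le_left (by positivity)]
        have h3 : (√T * √√(t : ℝ) / 3.36) ^ 2 = T * √t / 11.2896 := by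
          rw [div_pow, mul_pow, sq, sq, hsT, hst]; norm_num
        rw [h3, div_pow, mul_pow, Real.sq_sqrt ht0.le]
        apply div_le_div_of_nonneg_left (by positivity) (by norm_num) (by norm_num)
      exact (Real.sqrt_le_sqrt (Real.sqrt_le_sqrt (min_le_right _ _))).trans h2
    rw [h2t]
    calc √T * (√√2 * √√(t : ℝ)) / 4 * (6.5 * √√G)
        ≤ √T * (1.19 * √√(t : ℝ)) / 4 * (6.5 * (√T * √√(t : ℝ) / 3.36)) := by gcongr
      _ = (1.19 / 4 * 6.5 / 3.36) * ((√T * √T) * (√√(t : ℝ) * √√(t : ℝ))) := by ring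
      _ ≤ T * √t := by
        rw [hst, hsT]
        have : 0 ≤ T * √t := by positivity
        norm_num
        linarith
  · push Not at hT16
    have h4 : (4 : ℝ) ≤ √T := Real.le_sqrt_of_sq_le (by linarith)
    have h0 : thr T 0 = √T / 2 := by
      unfold thr
      rw [if_pos (by push_cast; nlinarith)]
      simp
    have hsum : ∑ m ∈ Finset.range J with ¬ 2 ^ (m + 1) ≤ t, 1 / √((2 : ℝ) ^ (m + 1))
        ≤ 3.5 / √t := by
      have h5 := sum_inv_sqrt_le J ht0
      refine le_trans (le_of_eq ?_) h5
      refine Finset.sum_congr (Finset.filter_congr fun m _ => ?_) fun _ _ => rfl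
      rw [not_le]
      exact_mod_cast Iff.rfl
    have h6 : thr T 0 * t * ∑ m ∈ Finset.range J with ¬ 2 ^ (m + 1) ≤ t,
        1 / √((2 : ℝ) ^ (m + 1)) ≤ 1.75 * (√T * √t) := by
      rw [h0]
      calc _ ≤ √T / 2 * t * (3.5 / √t) := by gcongr
        _ = _ := by
          have h7 : √(t : ℝ) * √t = t := Real.mul_self_sqrt ht0.le
          have h8 : 0 < √(t : ℝ) := Real.sqrt_pos.2 ht0
          field_simp
          rw [sq, h7]; ring
    have h9 : √T * √√(2 * t) / 4 * (6.5 * √√G) ≤ 1.94 * (√T * √t) := by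
      rw [h2t]
      have h10 : √√G ≤ √√(t : ℝ) := Real.sqrt_le_sqrt (Real.sqrt_le_sqrt (min_le_left _ _))
      calc √T * (√√2 * √√(t : ℝ)) / 4 * (6.5 * √√G)
          ≤ √T * (1.19 * √√(t : ℝ)) / 4 * (6.5 * √√(t : ℝ)) := by gcongr
        _ = (1.19 / 4 * 6.5) * (√T * (√√(t : ℝ) * √√(t : ℝ))) := by ring
        _ ≤ _ := by
          rw [hst]
          have : 0 ≤ √T * √t := by positivity
          norm_num
          linarith
    have h11 : 4 * (√T * √t) ≤ T * √t := by
      rw [← hsT, ← mul_assoc, hsT]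
      nth_rewrite 2 [← hsT]
      gcongr
    have : 0 ≤ √T * √t := by positivity
    linarith

/-! ### One-sided intervals -/

lemma sum_thr_mul_abs_haar_le {T : ℝ} (hT : 0 < T) (f : ℕ → ℝ) (c J : ℕ) :
    ∑ m ∈ Finset.range J, ∑ a ∈ Finset.range c, thr T a * |haar f c m a| ≤
      T * ∑ t ∈ Finset.Ico 1 c, √t * |f t - f (t - 1)| := by
  have hlevel : ∀ m, ∑ a ∈ Finset.range c, thr T a * |haar f c m a| ≤
      ∑ t ∈ Finset.Ico 1 c, thr T (t / 2 ^ (m + 1)) * haarKernel m t * |f t - f (t - 1)| := by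
    intro m
    have hpow : 0 < 2 ^ (m + 1) := by positivity
    rw [← Finset.sum_fiberwise_of_maps_to (s := Finset.Ico 1 c) (t := Finset.range c)
      (g := fun t => t / 2 ^ (m + 1)) (fun t ht => Finset.mem_range.2
        ((Nat.div_le_self _ _).trans_lt (Finset.mem_Ico.1 ht).2))]
    refine Finset.sum_le_sum fun a _ => ?_
    refine (mul_le_mul_of_nonneg_left (abs_haar_le f c m a) (thr_nonneg T a)).trans ?_
    rw [Finset.mul_sum]
    have hmem : ∀ t ∈ Finset.Ioo (a * 2 ^ (m + 1)) (min ((a + 1) * 2 ^ (m + 1)) c),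
        t ∈ Finset.Ico 1 c ∧ t / 2 ^ (m + 1) = a := by
      intro t ht
      rw [Finset.mem_Ioo, lt_min_iff] at ht
      refine ⟨Finset.mem_Ico.2 ⟨by omega, ht.2.2⟩, ?_⟩
      exact (Nat.div_eq_iff hpow).2 ⟨by omega, by have := ht.2.1; rw [add_one_mul] at this; omega⟩
    calc _ = ∑ t ∈ Finset.Ioo (a * 2 ^ (m + 1)) (min ((a + 1) * 2 ^ (m + 1)) c),
          thr T (t / 2 ^ (m + 1)) * haarKernel m t * |f t - f (t - 1)| :=
          Finset.sum_congr rfl fun t ht => by rw [(hmem t ht).2, mul_assoc]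
      _ ≤ _ := by
          refine Finset.sum_le_sum_of_subset_of_nonneg
            (fun t ht => Finset.mem_filter.2 (hmem t ht)) fun t _ _ => ?_
          exact mul_nonneg (mul_nonneg (thr_nonneg _ _) (haarKernel_nonneg _ _)) (abs_nonneg _)
  refine (Finset.sum_le_sum fun m _ => hlevel m).trans ?_
  rw [Finset.sum_comm, Finset.mul_sum]
  refine Finset.sum_le_sum fun t ht => ?_
  rw [← Finset.sum_mul, ← mul_assoc]
  exact mul_le_mul_of_nonneg_right
    (sum_thr_mul_haarKernel_le hT J (Finset.mem_Ico.1 ht).1) (abs_nonneg _)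

lemma sqrt_mul_sqrt_add_le {a b c d : ℝ} (ha : 0 ≤ a) (hb : 0 ≤ b) (hc : 0 ≤ c) (hd : 0 ≤ d) :
    √a * √b + √c * √d ≤ √(a + c) * √(b + d) := by
  rw [← Real.sqrt_mul (by positivity : 0 ≤ a + c)]
  apply Real.le_sqrt_of_sq_le
  nlinarith [sq_nonneg (√a * √d - √c * √b), Real.sq_sqrt ha, Real.sq_sqrt hb, Real.sq_sqrt hc,
    Real.sq_sqrt hd, mul_pow √a √b 2, mul_pow √c √d 2, mul_pow √a √d 2, mul_pow √c √b 2]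

/-- The energy of the mean and of the Haar coefficients of `e` that exceed their thresholds. -/
noncomputable def energy (T : ℝ) (c J : ℕ) (e : ℕ → ℝ) : ℝ :=
  (∑ i ∈ Finset.range c, e i) ^ 2 / c + ∑ m ∈ Finset.range J, ∑ a ∈ Finset.range c,
    if thr T a < |haar e c m a| then haar e c m a ^ 2 else 0

lemma energy_nonneg (T : ℝ) (c J : ℕ) (e : ℕ → ℝ) : 0 ≤ energy T c J e := by
  unfold energy
  refine add_nonneg (by positivity) (Finset.sum_nonneg fun m _ => Finset.sum_nonneg fun a _ => ?_)
  split_ifs <;> positivity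

/-- Small Haar coefficients are absorbed by the penalty, the others by the Cauchy-Schwarz
inequality. -/
theorem sum_mul_le_energy {T : ℝ} (hT : 0 < T) (e f : ℕ → ℝ) {c J : ℕ} (hJ : c ≤ 2 ^ J) :
    ∑ i ∈ Finset.range c, e i * f i ≤
      √(energy T c J e) * √(∑ i ∈ Finset.range c, f i ^ 2) +
        T * ∑ t ∈ Finset.Ico 1 c, √t * |f t - f (t - 1)| := by
  set A : ℝ := ∑ m ∈ Finset.range J, ∑ a ∈ Finset.range c,
    if thr T a < |haar e c m a| then haar e c m a ^ 2 else 0 with hA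
  set B : ℝ := ∑ m ∈ Finset.range J, ∑ a ∈ Finset.range c, haar f c m a ^ 2 with hB
  have hA0 : 0 ≤ A := Finset.sum_nonneg fun m _ => Finset.sum_nonneg fun a _ => by
    split_ifs <;> positivity
  have hB0 : 0 ≤ B := Finset.sum_nonneg fun m _ => Finset.sum_nonneg fun a _ => sq_nonneg _
  have hff : ∑ i ∈ Finset.range c, f i ^ 2 = (∑ i ∈ Finset.range c, f i) ^ 2 / c + B := by
    have := sum_mul_eq_haar f f hJ
    simpa only [← sq] using this
  have hcut : ∑ m ∈ Finset.range J, ∑ a ∈ Finset.range c,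
      (if thr T a < |haar e c m a| then |haar e c m a| else 0) * |haar f c m a| ≤ √A * √B := by
    rw [hA, hB, ← Finset.sum_product', ← Finset.sum_product', ← Finset.sum_product']
    refine (Real.sum_mul_le_sqrt_mul_sqrt _ _ _).trans (le_of_eq ?_)
    congr 2
    · refine Finset.sum_congr rfl fun x _ => ?_
      split_ifs <;> simp
    · exact Finset.sum_congr rfl fun x _ => sq_abs _
  have hpt : ∑ m ∈ Finset.range J, ∑ a ∈ Finset.range c, haar e c m a * haar f c m a ≤
      ∑ m ∈ Finset.range J, ∑ a ∈ Finset.range c,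
        (if thr T a < |haar e c m a| then |haar e c m a| else 0) * |haar f c m a| +
      ∑ m ∈ Finset.range J, ∑ a ∈ Finset.range c, thr T a * |haar f c m a| := by
    rw [← Finset.sum_add_distrib]
    refine Finset.sum_le_sum fun m _ => ?_
    rw [← Finset.sum_add_distrib]
    refine Finset.sum_le_sum fun a _ => ?_
    rw [← add_mul]
    refine (le_abs_self _).trans ?_
    rw [abs_mul]
    refine mul_le_mul_of_nonneg_right ?_ (abs_nonneg _)
    have := thr_nonneg T a
    split_ifs with h
    · linarith
    · linarith [not_lt.1 h]
  have hmean : (∑ i ∈ Finset.range c, e i) * (∑ i ∈ Finset.range c, f i) / c ≤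
      √((∑ i ∈ Finset.range c, e i) ^ 2 / c) * √((∑ i ∈ Finset.range c, f i) ^ 2 / c) := by
    rw [← Real.sqrt_mul (by positivity), div_mul_div_comm, ← mul_pow, ← sq, ← div_pow]
    exact Real.le_sqrt_of_sq_le le_rfl
  have h1 := sqrt_mul_sqrt_add_le (a := (∑ i ∈ Finset.range c, e i) ^ 2 / c)
    (b := (∑ i ∈ Finset.range c, f i) ^ 2 / c) (by positivity) (by positivity) hA0 hB0
  have h2 := sum_thr_mul_abs_haar_le hT f c J
  rw [sum_mul_eq_haar e f hJ, hff]
  unfold energy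
  linarith

/-- A bound for the expected energy of a Haar coefficient beyond its threshold. -/
noncomputable def excessBound (T : ℝ) (a : ℕ) : ℝ :=
  if 256 ≤ T ^ 2 * (1 + a) then 6656 / (T ^ 2 * (1 + a)) ^ 2 else 0.27

lemma sum_excessBound_le {T : ℝ} (hT : 0 < T) (c : ℕ) :
    ∑ a ∈ Finset.range c, excessBound T a ≤ 122 / T ^ 2 := by
  set u : ℝ := 256 / T ^ 2 with hu
  have hT2 : 0 < T ^ 2 := by positivity
  have hu0 : 0 < u := by positivity
  have hiff : ∀ a : ℕ, 256 ≤ T ^ 2 * (1 + a) ↔ u ≤ 1 + a := by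
    intro a; rw [hu, div_le_iff₀' hT2]
  unfold excessBound
  rw [Finset.sum_ite]
  have h1 : ∑ a ∈ (Finset.range c).filter (fun a : ℕ => ¬ 256 ≤ T ^ 2 * (1 + (a : ℝ))),
      (0.27 : ℝ) ≤ 0.27 * u := by
    rw [Finset.sum_const, nsmul_eq_mul, mul_comm]
    refine mul_le_mul_of_nonneg_left ?_ (by norm_num)
    have h2 : ((Finset.range c).filter fun a : ℕ => ¬ 256 ≤ T ^ 2 * (1 + (a : ℝ))) ⊆
        Finset.range ⌊u⌋₊ := by
      intro a ha
      have ha' := (Finset.mem_filter.1 ha).2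
      rw [hiff, not_le] at ha'
      have : a + 1 ≤ ⌊u⌋₊ := Nat.le_floor (by push_cast; linarith)
      exact Finset.mem_range.2 (by omega)
    have h3 := Finset.card_le_card h2
    rw [Finset.card_range] at h3
    exact (Nat.cast_le.2 h3).trans (Nat.floor_le hu0.le)
  have h2 : ∑ a ∈ (Finset.range c).filter (fun a : ℕ => 256 ≤ T ^ 2 * (1 + (a : ℝ))),
      6656 / (T ^ 2 * (1 + (a : ℝ))) ^ 2 ≤ 6656 / (T ^ 2) ^ 2 * (2 / u) := by
    have hN : 0 < ⌈u⌉₊ := Nat.ceil_pos.2 hu0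
    have h3 : ∑ a ∈ (Finset.range c).filter (fun a : ℕ => 256 ≤ T ^ 2 * (1 + (a : ℝ))),
        (((a + 1 : ℕ) : ℝ) ^ 2)⁻¹ ≤ 2 / u := by
      have h4 := sum_Ioo_inv_sq_le (α := ℝ) (⌈u⌉₊ - 1) (c + 1)
      have h5 : ((⌈u⌉₊ - 1 : ℕ) : ℝ) + 1 = ⌈u⌉₊ := by
        rw [Nat.cast_sub hN]; push_cast; ring
      rw [h5] at h4
      refine le_trans ?_ (h4.trans (div_le_div_of_nonneg_left (by norm_num) hu0 (Nat.le_ceil u)))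
      rw [← Finset.sum_image (f := fun i : ℕ => ((i : ℝ) ^ 2)⁻¹)
        (g := fun a : ℕ => a + 1) (fun a _ b _ h => Nat.succ_injective h)]
      refine Finset.sum_le_sum_of_subset_of_nonneg ?_ fun _ _ _ => by positivity
      intro i hi
      obtain ⟨a, ha, rfl⟩ := Finset.mem_image.1 hi
      obtain ⟨ha1, ha2⟩ := Finset.mem_filter.1 ha
      rw [hiff] at ha2
      have : ⌈u⌉₊ ≤ a + 1 := Nat.ceil_le.2 (by push_cast; linarith)
      have := Finset.mem_range.1 ha1
      exact Finset.mem_Ioo.2 ⟨by omega, by omega⟩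
    refine le_trans (le_of_eq ?_) (mul_le_mul_of_nonneg_left h3 (by positivity))
    rw [Finset.mul_sum]
    refine Finset.sum_congr rfl fun a _ => ?_
    rw [mul_pow]
    push_cast
    rw [add_comm (1 : ℝ)]
    field_simp
  have h3 : 6656 / (T ^ 2) ^ 2 * (2 / u) = 52 / T ^ 2 := by rw [hu]; field_simp; norm_num
  have h4 : 0.27 * u ≤ 70 / T ^ 2 := by
    rw [hu, ← mul_div_assoc]; gcongr; norm_num
  have h5 : 122 / T ^ 2 = 52 / T ^ 2 + 70 / T ^ 2 := by rw [← add_div]; norm_num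
  linarith

lemma ite_thr_sq_le {T : ℝ} (hT : 0 < T) {a : ℕ} (h : 256 ≤ T ^ 2 * (1 + a)) (z : ℝ) :
    (if thr T a < |z| then z ^ 2 else 0) ≤ 256 / (T ^ 2 * (1 + a)) ^ 2 * z ^ 10 := by
  split_ifs with hz
  · have h1 : thr T a ^ 8 = (T ^ 2 * (1 + a)) ^ 2 / 256 := by
      rw [thr, if_pos h, div_pow, show (8 : ℕ) = 2 * 4 from rfl, pow_mul, Real.sq_sqrt (by positivity),
        mul_pow, show √(1 + (a : ℝ)) ^ 4 = (√(1 + (a : ℝ)) ^ 2) ^ 2 by ring,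
        Real.sq_sqrt (by positivity)]
      norm_num
      ring
    have h2 : thr T a ^ 8 ≤ z ^ 8 := by
      have := pow_le_pow_left₀ (thr_nonneg T a) hz.le 8
      rwa [Even.pow_abs (by decide)] at this
    rw [h1] at h2
    have hpos : 0 < (T ^ 2 * (1 + (a : ℝ))) ^ 2 := by positivity
    rw [div_mul_eq_mul_div, le_div_iff₀ hpos]
    calc z ^ 2 * (T ^ 2 * (1 + (a : ℝ))) ^ 2
        = 256 * (z ^ 2 * ((T ^ 2 * (1 + (a : ℝ))) ^ 2 / 256)) := by ring
      _ ≤ 256 * (z ^ 2 * z ^ 8) := by gcongr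
      _ = _ := by ring
  · have : 0 ≤ z ^ 10 := Even.pow_nonneg (by decide) z
    positivity

lemma haar_add (e f : ℕ → ℝ) (c m a : ℕ) : haar (e + f) c m a = haar e c m a + haar f c m a := by
  unfold haar blockSum
  simp only [Pi.add_apply, Finset.sum_add_distrib]
  ring

lemma haar_smul (r : ℝ) (f : ℕ → ℝ) (c m a : ℕ) : haar (r • f) c m a = r * haar f c m a := by
  unfold haar blockSum
  simp only [Pi.smul_apply, smul_eq_mul, ← Finset.mul_sum]
  ring

/-- A linear functional of norm at most `1` is given by a vector of norm at most `1`. -/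
lemma exists_coeff {n : ℕ} {φ : (Fin n → ℝ) → ℝ} (hadd : ∀ v w, φ (v + w) = φ v + φ w)
    (hsmul : ∀ (r : ℝ) v, φ (r • v) = r * φ v) (hφ : ∀ v, φ v ^ 2 ≤ ∑ i, v i ^ 2) :
    ∃ h : Fin n → ℝ, ∑ i, h i ^ 2 ≤ 1 ∧ ∀ v, φ v = ∑ i, h i * v i := by
  set φ' : (Fin n → ℝ) →ₗ[ℝ] ℝ := ⟨⟨φ, hadd⟩, hsmul⟩
  have h1 : ∀ v, φ v = ∑ i, φ (fun j => if i = j then 1 else 0) * v i := by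
    intro v
    have := φ'.pi_apply_eq_sum_univ v
    refine this.trans (Finset.sum_congr rfl fun i _ => ?_)
    rw [smul_eq_mul, mul_comm]
    rfl
  refine ⟨fun i => φ (fun j => if i = j then 1 else 0), ?_, h1⟩
  -- Testing the functional on its own coefficient vector.
  have h2 := hφ fun i => φ (fun j => if i = j then 1 else 0)
  rw [h1] at h2
  simp only [← sq] at h2
  by_contra! h3
  nlinarith

section Energy

variable {Ω : Type*} [MeasurableSpace Ω] {P : Measure Ω} [IsProbabilityMeasure P] {n : ℕ}
  {Y : Fin n → Ω → ℝ}

/-- The expected energy of the noise, seen through a linear map `E` that does not increase the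
Euclidean norm on `{0, …, c - 1}`. -/
theorem integral_energy_le (hm : ∀ i, Measurable (Y i)) (h01 : ∀ i ω, Y i ω = 0 ∨ Y i ω = 1)
    (hI : iIndepFun Y P) {T : ℝ} (hT : 0 < T) (c J : ℕ) (E : (Fin n → ℝ) →ₗ[ℝ] (ℕ → ℝ))
    (hE : ∀ v, ∑ i ∈ Finset.range c, E v i ^ 2 ≤ ∑ i, v i ^ 2) :
    ∫ ω, energy T c J (E fun i => noise P Y i ω) ∂P ≤ 0.27 + J * (122 / T ^ 2) := by
  have hint : ∀ h : (Fin n → ℝ) → ℝ, Integrable (fun ω => h fun i => noise P Y i ω) P :=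
    integrable_comp_noise hm h01
  unfold energy
  rw [integral_add (hint fun v => (∑ i ∈ Finset.range c, E v i) ^ 2 / c)
    (hint fun v => ∑ m ∈ Finset.range J, ∑ a ∈ Finset.range c,
      if thr T a < |haar (E v) c m a| then haar (E v) c m a ^ 2 else 0)]
  refine add_le_add ?_ ?_
  · have hs : (√(c : ℝ)) ^ 2 = c := Real.sq_sqrt (Nat.cast_nonneg c)
    obtain ⟨h, hh, hφ⟩ := exists_coeff (φ := fun v => (∑ i ∈ Finset.range c, E v i) / √c)
      (fun v w => by simp only [map_add, Pi.add_apply, Finset.sum_add_distrib, add_div])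
      (fun r v => by
        simp only [map_smul, Pi.smul_apply, smul_eq_mul, ← Finset.mul_sum, mul_div_assoc])
      (fun v => by
        rw [div_pow, hs]
        exact (sq_sum_div_le _ _).trans (hE v))
    have : ∀ v, (∑ i ∈ Finset.range c, E v i) ^ 2 / c = (∑ i, h i * v i) ^ 2 := by
      intro v
      rw [← hφ, div_pow, hs]
    simp only [this]
    exact integral_sq_noise_le hm h01 hI hh
  · rw [integral_finsetSum _ fun m _ => hint fun v => ∑ a ∈ Finset.range c,
      if thr T a < |haar (E v) c m a| then haar (E v) c m a ^ 2 else 0]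
    have hlevel : ∀ m ∈ Finset.range J, ∫ ω, ∑ a ∈ Finset.range c,
        (if thr T a < |haar (E fun i => noise P Y i ω) c m a|
          then haar (E fun i => noise P Y i ω) c m a ^ 2 else 0) ∂P ≤ 122 / T ^ 2 := by
      intro m _
      refine le_trans ?_ (sum_excessBound_le hT c)
      rw [integral_finsetSum _ fun a _ => hint fun v =>
        if thr T a < |haar (E v) c m a| then haar (E v) c m a ^ 2 else 0]
      refine Finset.sum_le_sum fun a _ => ?_
      obtain ⟨h, hh, hφ⟩ := exists_coeff (φ := fun v => haar (E v) c m a)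
        (fun v w => by rw [map_add, haar_add]) (fun r v => by rw [map_smul, haar_smul])
        (fun v => (sq_haar_le _).trans (hE v))
      simp only [hφ]
      unfold excessBound
      split_ifs with hc
      · have h1 := integral_mono (μ := P)
          (hint fun v => if thr T a < |∑ i, h i * v i| then (∑ i, h i * v i) ^ 2 else 0)
          (hint fun v => 256 / (T ^ 2 * (1 + (a : ℝ))) ^ 2 * (∑ i, h i * v i) ^ 10)
          fun ω => ite_thr_sq_le hT hc _
        refine h1.trans ?_
        rw [integral_const_mul]
        calc _ ≤ 256 / (T ^ 2 * (1 + (a : ℝ))) ^ 2 * 26 :=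
              mul_le_mul_of_nonneg_left (integral_pow_ten_noise_le hm h01 hI hh) (by positivity)
          _ = _ := by ring
      · refine le_trans (integral_mono (μ := P)
          (hint fun v => if thr T a < |∑ i, h i * v i| then (∑ i, h i * v i) ^ 2 else 0)
          (hint fun v => (∑ i, h i * v i) ^ 2) fun ω => ?_) (integral_sq_noise_le hm h01 hI hh)
        dsimp only
        split_ifs
        · exact le_rfl
        · positivity
    refine (Finset.sum_le_sum hlevel).trans ?_
    rw [Finset.sum_const, Finset.card_range, nsmul_eq_mul]

end Energy

/-! ### Splitting along the jumps -/

lemma entry_succ {n : ℕ} (f : Fin n → ℝ) (i : Fin n) : entry f (i + 1) = f i := by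
  unfold entry
  rw [dif_pos ⟨by omega, by omega⟩]
  congr 1

lemma entry_add {n : ℕ} (f g : Fin n → ℝ) (k : ℕ) : entry (f + g) k = entry f k + entry g k := by
  unfold entry
  split_ifs <;> simp

lemma entry_smul {n : ℕ} (r : ℝ) (f : Fin n → ℝ) (k : ℕ) : entry (r • f) k = r * entry f k := by
  unfold entry
  split_ifs <;> simp

lemma sum_Icc_entry {n : ℕ} (e f : Fin n → ℝ) (g : ℝ → ℝ → ℝ) :
    ∑ k ∈ Finset.Icc 1 n, g (entry e k) (entry f k) = ∑ i, g (e i) (f i) := by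
  rw [← Finset.Ico_add_one_right_eq_Icc, Finset.sum_Ico_eq_sum_range, Nat.add_sub_cancel,
    ← Fin.sum_univ_eq_sum_range (fun k => g (entry e (1 + k)) (entry f (1 + k)))]
  refine Finset.sum_congr rfl fun i _ => ?_
  rw [add_comm, entry_succ, entry_succ]

section Blocks

variable {n : ℕ} {S : Finset ℕ}

lemma leftEnd_spec {k : ℕ} (hk : 1 ≤ k) :
    leftEnd S k ∈ insert 1 S ∧ leftEnd S k ≤ k ∧ ∀ τ ∈ insert 1 S, τ ≤ k → τ ≤ leftEnd S k := by
  have hb : BddAbove {τ | (τ = 1 ∨ τ ∈ S) ∧ τ ≤ k} := ⟨k, fun τ h => h.2⟩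
  have h := Nat.sSup_mem (s := {τ | (τ = 1 ∨ τ ∈ S) ∧ τ ≤ k}) ⟨1, Or.inl rfl, hk⟩ hb
  exact ⟨Finset.mem_insert.2 h.1, h.2,
    fun τ hτ hk => le_csSup hb ⟨Finset.mem_insert.1 hτ, hk⟩⟩

lemma rightEnd_spec {k : ℕ} (hk : k ≤ n) :
    (rightEnd n S k = n + 1 ∨ rightEnd n S k ∈ S) ∧ k < rightEnd n S k ∧ rightEnd n S k ≤ n + 1 ∧
      ∀ τ ∈ S, k < τ → rightEnd n S k ≤ τ := by
  have hne : n + 1 ∈ {τ | (τ = n + 1 ∨ τ ∈ S) ∧ k < τ} := ⟨Or.inl rfl, by omega⟩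
  have h := Nat.sInf_mem (s := {τ | (τ = n + 1 ∨ τ ∈ S) ∧ k < τ}) ⟨_, hne⟩
  exact ⟨h.1, h.2, Nat.sInf_le hne, fun τ hτ hk => Nat.sInf_le ⟨Or.inr hτ, hk⟩⟩

variable (hS : S ⊆ Finset.Icc 2 n) (hn : 0 < n)
include hS hn

lemma block_bounds {l : ℕ} (hl : l ∈ insert 1 S) :
    1 ≤ l ∧ l < rightEnd n S l ∧ rightEnd n S l ≤ n + 1 := by
  have h : 1 ≤ l ∧ l ≤ n := by
    rcases Finset.mem_insert.1 hl with rfl | h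
    · omega
    · have := Finset.mem_Icc.1 (hS h); omega
  have := rightEnd_spec (S := S) h.2
  exact ⟨h.1, this.2.1, this.2.2.1⟩

lemma leftEnd_eq {l k : ℕ} (hl : l ∈ insert 1 S) (h1 : l ≤ k) (h2 : k < rightEnd n S l) :
    leftEnd S k = l := by
  have hb := block_bounds hS hn hl
  have hL := leftEnd_spec (S := S) (hb.1.trans h1)
  refine le_antisymm ?_ (hL.2.2 l hl h1)
  by_contra! h
  rcases Finset.mem_insert.1 hL.1 with h3 | h3
  · omega
  · have := (rightEnd_spec (S := S) (n := n) (k := l) (by omega)).2.2.2 _ h3 h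
    omega

lemma rightEnd_eq {l k : ℕ} (hl : l ∈ insert 1 S) (h1 : l ≤ k) (h2 : k < rightEnd n S l) :
    rightEnd n S k = rightEnd n S l := by
  have hb := block_bounds hS hn hl
  have hR := rightEnd_spec (S := S) (n := n) (k := l) (by omega)
  have hR' := rightEnd_spec (S := S) (n := n) (k := k) (by omega)
  refine le_antisymm ?_ ?_
  · rcases hR.1 with h | h
    · rw [h]; exact hR'.2.2.1
    · exact hR'.2.2.2 _ h h2
  · rcases hR'.1 with h | h
    · rw [h]; exact hb.2.2
    · exact hR.2.2.2 _ h (by omega)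

lemma mem_block {k : ℕ} (h1 : 1 ≤ k) (h2 : k ≤ n) : k < rightEnd n S (leftEnd S k) := by
  have hL := leftEnd_spec (S := S) h1
  have hb := block_bounds hS hn hL.1
  have hR := rightEnd_spec (S := S) (n := n) (k := leftEnd S k) (by omega)
  by_contra! h
  rcases hR.1 with h3 | h3
  · omega
  · have := hL.2.2 _ (Finset.mem_insert_of_mem h3) h
    omega

lemma notMem_of_mem_block {l k : ℕ} (hl : l ∈ insert 1 S) (h1 : l < k)
    (h2 : k < rightEnd n S l) : k ∉ S := by
  intro hk
  have hb := block_bounds hS hn hl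
  have := (rightEnd_spec (S := S) (n := n) (k := l) (by omega)).2.2.2 k hk h1
  omega

lemma sum_blocks (φ : ℕ → ℝ) : ∑ k ∈ Finset.Icc 1 n, φ k =
    ∑ l ∈ insert 1 S, ∑ k ∈ Finset.Ico l (rightEnd n S l), φ k := by
  rw [← Finset.sum_fiberwise_of_maps_to (s := Finset.Icc 1 n) (t := insert 1 S) (g := leftEnd S)
    (fun k hk => (leftEnd_spec (Finset.mem_Icc.1 hk).1).1)]
  refine Finset.sum_congr rfl fun l hl => Finset.sum_congr ?_ fun _ _ => rfl
  have hb := block_bounds hS hn hl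
  ext k
  simp only [Finset.mem_filter, Finset.mem_Icc, Finset.mem_Ico]
  constructor
  · rintro ⟨⟨h1, h2⟩, rfl⟩
    exact ⟨(leftEnd_spec h1).2.1, mem_block hS hn h1 h2⟩
  · rintro ⟨h1, h2⟩
    exact ⟨⟨by omega, by omega⟩, leftEnd_eq hS hn hl h1 h2⟩

lemma sum_block_interiors (φ : ℕ → ℝ) : ∑ k ∈ Finset.Icc 2 n \ S, φ k =
    ∑ l ∈ insert 1 S, ∑ k ∈ Finset.Ioo l (rightEnd n S l), φ k := by
  rw [← Finset.sum_fiberwise_of_maps_to (s := Finset.Icc 2 n \ S) (t := insert 1 S)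
    (g := leftEnd S) (fun k hk => (leftEnd_spec (by
      have := Finset.mem_Icc.1 (Finset.mem_sdiff.1 hk).1; omega)).1)]
  refine Finset.sum_congr rfl fun l hl => Finset.sum_congr ?_ fun _ _ => rfl
  have hb := block_bounds hS hn hl
  ext k
  simp only [Finset.mem_filter, Finset.mem_sdiff, Finset.mem_Icc, Finset.mem_Ioo]
  constructor
  · rintro ⟨⟨⟨h1, h2⟩, h3⟩, rfl⟩
    have hL := leftEnd_spec (S := S) (k := k) (by omega)
    refine ⟨lt_of_le_of_ne hL.2.1 ?_, mem_block hS hn (by omega) h2⟩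
    intro h
    rcases Finset.mem_insert.1 hL.1 with h4 | h4
    · omega
    · rw [h] at h4; exact h3 h4
  · rintro ⟨h1, h2⟩
    exact ⟨⟨⟨by omega, by omega⟩, notMem_of_mem_block hS hn hl h1 h2⟩,
      leftEnd_eq hS hn hl h1.le h2⟩

lemma weight_eq {l k : ℕ} (hl : l ∈ insert 1 S) (h1 : l < k) (h2 : k < rightEnd n S l) :
    weight n S k = √(((k : ℝ) - l) / ((rightEnd n S l : ℝ) - l) *
      (((rightEnd n S l : ℝ) - k) / n)) := by
  rw [weight, if_neg (notMem_of_mem_block hS hn hl h1 h2), leftEnd_eq hS hn hl h1.le h2,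
    rightEnd_eq hS hn hl h1.le h2]

omit hS hn

lemma sum_Ico_two_sided (φ : ℕ → ℝ) {l r c : ℕ} (h1 : l + c ≤ r) :
    ∑ k ∈ Finset.Ico l r, φ k = ∑ i ∈ Finset.range c, φ (l + i) +
      ∑ i ∈ Finset.range (r - l - c), φ (r - 1 - i) := by
  rw [← Finset.sum_Ico_consecutive φ (Nat.le_add_right l c) h1, Finset.sum_Ico_eq_sum_range,
    Nat.add_sub_cancel_left, Finset.sum_Ico_eq_sum_range,
    ← Finset.sum_range_reflect fun i => φ (l + c + i)]
  congr 1
  refine Finset.sum_congr (by rw [Nat.sub_sub]) fun i hi => ?_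
  have := Finset.mem_range.1 hi
  congr 1
  omega

/-- Both halves of a block, seen from the ends of the block, only use cuts inside the block. -/
lemma sum_two_sided_le {ψ : ℕ → ℝ} (hψ : ∀ k, 0 ≤ ψ k) {l r c : ℕ} (h1 : l + c ≤ r) :
    ∑ t ∈ Finset.Ico 1 c, ψ (l + t) + ∑ t ∈ Finset.Ico 1 (r - l - c), ψ (r - t) ≤
      ∑ k ∈ Finset.Ioo l r, ψ k := by
  rw [← Finset.sum_image (f := ψ) (s := Finset.Ico 1 c) (g := fun t => l + t)
      (fun a _ b _ h => Nat.add_left_cancel h),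
    ← Finset.sum_image (f := ψ) (s := Finset.Ico 1 (r - l - c)) (g := fun t => r - t)
      (fun a ha b hb h => by
        have ha' := Finset.mem_Ico.1 (Finset.mem_coe.1 ha)
        have hb' := Finset.mem_Ico.1 (Finset.mem_coe.1 hb)
        dsimp only at h; omega), ← Finset.sum_union]
  · refine Finset.sum_le_sum_of_subset_of_nonneg ?_ fun k _ _ => hψ k
    intro k hk
    rcases Finset.mem_union.1 hk with h | h
    · obtain ⟨t, ht, rfl⟩ := Finset.mem_image.1 h
      have := Finset.mem_Ico.1 ht
      exact Finset.mem_Ioo.2 (by omega)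
    · obtain ⟨t, ht, rfl⟩ := Finset.mem_image.1 h
      have := Finset.mem_Ico.1 ht
      exact Finset.mem_Ioo.2 (by omega)
  · rw [Finset.disjoint_left]
    intro k h h'
    obtain ⟨t, ht, rfl⟩ := Finset.mem_image.1 h
    obtain ⟨t', ht', h3⟩ := Finset.mem_image.1 h'
    have := Finset.mem_Ico.1 ht
    have := Finset.mem_Ico.1 ht'
    omega

end Blocks

/-- The number of dyadic levels used for a block of length `d`, each half of which has length at
most `(d + 1) / 2`. -/
def levels (d : ℕ) : ℕ := Nat.clog 2 ((d + 1) / 2)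

lemma le_two_pow_levels (d : ℕ) : (d + 1) / 2 ≤ 2 ^ levels d := Nat.le_pow_clog (by norm_num) _

lemma two_pow_levels_le {d : ℕ} (hd : 1 ≤ d) : 2 ^ levels d ≤ d := by
  rcases Nat.eq_zero_or_pos (levels d) with h | h
  · rw [h]; simpa using hd
  · have h1 : 1 < (d + 1) / 2 := by
      by_contra! h2
      have : levels d = 0 := Nat.clog_of_right_le_one h2 2
      omega
    have h2 := Nat.pow_pred_clog_lt_self (b := 2) (by norm_num) h1
    have h3 : 2 ^ levels d = 2 * 2 ^ (Nat.clog 2 ((d + 1) / 2)).pred := by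
      rw [← pow_succ']
      congr 1
      rw [Nat.pred_eq_sub_one]
      exact (Nat.sub_add_cancel h).symm
    omega

lemma levels_le_sum {l r : ℕ} (h : l < r) :
    1.386 * (levels (r - l) : ℝ) ≤
      ∑ k ∈ Finset.Ioo l r, (1 / ((k : ℝ) - l) + 1 / ((r : ℝ) - k)) := by
  obtain ⟨d, rfl⟩ : ∃ d, r = l + (d + 1) := ⟨r - l - 1, by omega⟩
  have hset : Finset.Ioo l (l + (d + 1)) = Finset.Ico (l + 1) (l + (d + 1)) := by
    ext; simp only [Finset.mem_Ioo, Finset.mem_Ico]; omega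
  have h1 : ∑ k ∈ Finset.Ioo l (l + (d + 1)), 1 / ((k : ℝ) - l) = harmonic d := by
    rw [hset, Finset.sum_Ico_eq_sum_range, harmonic]
    push_cast
    refine Finset.sum_congr (by congr 1; omega) fun i _ => ?_
    rw [one_div]; congr 1; ring
  have h2 : ∑ k ∈ Finset.Ioo l (l + (d + 1)), 1 / (((l + (d + 1) : ℕ) : ℝ) - k) = harmonic d := by
    rw [hset, Finset.sum_Ico_eq_sum_range, ← Finset.sum_range_reflect, harmonic]
    push_cast
    refine Finset.sum_congr (by congr 1; omega) fun i hi => ?_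
    have hi' := Finset.mem_range.1 hi
    rw [one_div]
    congr 1
    have h3 : l + (d + 1) - (l + 1) - 1 - i + (i + 1) = d := by omega
    have h4 : ((l + (d + 1) - (l + 1) - 1 - i : ℕ) : ℝ) + (i + 1) = d := by exact_mod_cast h3
    linarith
  rw [Finset.sum_add_distrib, h1, h2]
  have h3 := log_add_one_le_harmonic d
  have h4 : (levels (d + 1) : ℝ) * Real.log 2 ≤ Real.log ((d + 1 : ℕ) : ℝ) := by
    rw [← Real.log_pow]
    refine Real.log_le_log (by positivity) ?_
    exact_mod_cast two_pow_levels_le (d := d + 1) (by omega)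
  have h5 := Real.log_two_gt_d9
  have h6 : l + (d + 1) - l = d + 1 := by omega
  rw [h6]
  have h7 : (0 : ℝ) ≤ levels (d + 1) := Nat.cast_nonneg _
  nlinarith

/-! ### The expected size of the penalized noise -/

section Total

variable {n : ℕ} {S : Finset ℕ}

/-- The sum of the energies of both halves of all blocks. -/
noncomputable def totalEnergy (T : ℝ) (n : ℕ) (S : Finset ℕ) (v : Fin n → ℝ) : ℝ :=
  ∑ l ∈ insert 1 S,
    (energy T ((rightEnd n S l - l + 1) / 2) (levels (rightEnd n S l - l))
        (fun i => entry v (l + i)) +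
      energy T (rightEnd n S l - l - (rightEnd n S l - l + 1) / 2) (levels (rightEnd n S l - l))
        (fun i => entry v (rightEnd n S l - 1 - i)))

lemma totalEnergy_nonneg (T : ℝ) (v : Fin n → ℝ) : 0 ≤ totalEnergy T n S v :=
  Finset.sum_nonneg fun _ _ => add_nonneg (energy_nonneg _ _ _ _) (energy_nonneg _ _ _ _)

lemma penalty_le (hS : S ⊆ Finset.Icc 2 n) (hn : 0 < n) {ν lam : ℝ} (hν : 0 < ν)
    (hlam : 4 / ν / √n ≤ lam) {l k t : ℕ} (hl : l ∈ insert 1 S) (h1 : l < k)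
    (h2 : k < rightEnd n S l)
    (ht : (t : ℝ) / 2 * ((rightEnd n S l : ℝ) - l) ≤ ((k : ℝ) - l) * ((rightEnd n S l : ℝ) - k)) :
    √8 / ν * √t ≤ n * lam * weight n S k := by
  have hn' : (0 : ℝ) < n := by exact_mod_cast hn
  have hd : (0 : ℝ) < (rightEnd n S l : ℝ) - l := by
    have : (l : ℝ) < rightEnd n S l := by exact_mod_cast h1.trans h2
    linarith
  have hw : √(t / (2 * n)) ≤ weight n S k := by
    rw [weight_eq hS hn hl h1 h2]
    apply Real.sqrt_le_sqrt
    rw [div_mul_div_comm, div_le_div_iff₀ (by positivity) (by positivity)]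
    nlinarith
  have hsn : √(n : ℝ) * √n = n := Real.mul_self_sqrt hn'.le
  have hsn0 : 0 < √(n : ℝ) := Real.sqrt_pos.2 hn'
  have h8 : √(8 : ℝ) * √2 = 4 := by
    rw [← Real.sqrt_mul (by norm_num)]
    rw [show (8 : ℝ) * 2 = 4 ^ 2 by norm_num, Real.sqrt_sq (by norm_num)]
  have h20 : 0 < √(2 : ℝ) := by positivity
  calc √8 / ν * √t = n * (4 / ν / √n) * √(t / (2 * n)) := by
        rw [Real.sqrt_div' _ (by positivity), Real.sqrt_mul (by norm_num), ← h8]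
        nth_rewrite 1 [← hsn]
        field_simp
    _ ≤ n * lam * weight n S k := by
        have hlam0 : 0 ≤ lam := le_trans (by positivity) hlam
        exact mul_le_mul (mul_le_mul_of_nonneg_left hlam hn'.le) hw (Real.sqrt_nonneg _)
          (by positivity)

lemma half_mul_le {x y t : ℝ} (ht : 0 ≤ t) (hx : t ≤ x) (hy : t ≤ y) (h : x = t ∨ y = t) :
    t / 2 * (x + y) ≤ x * y := by
  rcases h with h | h <;> subst h <;> nlinarith

/-- The noise is dominated by the penalty, up to the part that is measured by the total energy. -/
lemma sum_mul_le_totalEnergy (hS : S ⊆ Finset.Icc 2 n) (hn : 0 < n) {ν lam : ℝ} (hν : 0 < ν)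
    (hlam : 4 / ν / √n ≤ lam) (v f : Fin n → ℝ) :
    ∑ i, v i * f i ≤ √(totalEnergy (√8 / ν) n S v) * √(∑ i, f i ^ 2) +
      n * lam * weightedTV S f := by
  have hT : 0 < √8 / ν := by positivity
  have hlam0 : 0 ≤ lam := le_trans (by positivity) hlam
  set ψ : ℕ → ℝ := fun k => n * lam * |weight n S k * diff f k| with hψ
  have hψ0 : ∀ k, 0 ≤ ψ k := fun k => by positivity
  set B : ℕ → ℝ := fun l => ∑ k ∈ Finset.Ico l (rightEnd n S l), entry f k ^ 2 with hB
  set A : ℕ → ℝ := fun l => energy (√8 / ν) ((rightEnd n S l - l + 1) / 2)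
      (levels (rightEnd n S l - l)) (fun i => entry v (l + i)) +
      energy (√8 / ν) (rightEnd n S l - l - (rightEnd n S l - l + 1) / 2)
      (levels (rightEnd n S l - l)) (fun i => entry v (rightEnd n S l - 1 - i)) with hA
  have hblock : ∀ l ∈ insert 1 S, ∑ k ∈ Finset.Ico l (rightEnd n S l), entry v k * entry f k ≤
      √(A l) * √(B l) + ∑ k ∈ Finset.Ioo l (rightEnd n S l), ψ k := by
    intro l hl
    have hb := block_bounds hS hn hl
    set r := rightEnd n S l with hr
    set c := (r - l + 1) / 2 with hc
    have hlc : l + c ≤ r := by omega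
    have hJ := le_two_pow_levels (r - l)
    have h1 := sum_mul_le_energy hT (fun i => entry v (l + i)) (fun i => entry f (l + i)) hJ
    have h2 := sum_mul_le_energy hT (fun i => entry v (r - 1 - i)) (fun i => entry f (r - 1 - i))
      (c := r - l - c) (J := levels (r - l)) (by omega)
    have h3 : √8 / ν * ∑ t ∈ Finset.Ico 1 c, √t * |entry f (l + t) - entry f (l + (t - 1))| ≤
        ∑ t ∈ Finset.Ico 1 c, ψ (l + t) := by
      rw [Finset.mul_sum]
      refine Finset.sum_le_sum fun t ht => ?_
      have ht' := Finset.mem_Ico.1 ht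
      have hdiff : entry f (l + t) - entry f (l + (t - 1)) = diff f (l + t) := by
        rw [diff, Nat.add_sub_assoc ht'.1]
      have hw := penalty_le hS hn hν hlam hl (k := l + t) (t := t) (by omega) (by omega) (by
        have e : (r : ℝ) - l = (((l + t : ℕ) : ℝ) - l) + ((r : ℝ) - (l + t : ℕ)) := by ring
        have h4 : (l : ℝ) + t + t ≤ r := by
          have : l + t + t ≤ r := by omega
          exact_mod_cast this
        rw [← hr, e]
        push_cast
        exact half_mul_le (Nat.cast_nonneg t) (by linarith) (by linarith) (Or.inl (by ring)))
      rw [hdiff, hψ]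
      dsimp only
      rw [abs_mul, ← mul_assoc, ← mul_assoc]
      exact mul_le_mul_of_nonneg_right (hw.trans (mul_le_mul_of_nonneg_left (le_abs_self _)
        (by positivity))) (abs_nonneg _)
    have h4 : √8 / ν * ∑ t ∈ Finset.Ico 1 (r - l - c),
        √t * |entry f (r - 1 - t) - entry f (r - 1 - (t - 1))| ≤
        ∑ t ∈ Finset.Ico 1 (r - l - c), ψ (r - t) := by
      rw [Finset.mul_sum]
      refine Finset.sum_le_sum fun t ht => ?_
      have ht' := Finset.mem_Ico.1 ht
      have hdiff : |entry f (r - 1 - t) - entry f (r - 1 - (t - 1))| = |diff f (r - t)| := by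
        rw [diff, abs_sub_comm]
        have e1 : r - 1 - (t - 1) = r - t := by omega
        have e2 : r - 1 - t = r - t - 1 := by omega
        rw [e1, e2]
      have hw := penalty_le hS hn hν hlam hl (k := r - t) (t := t) (by omega) (by omega) (by
        have e0 : ((r - t : ℕ) : ℝ) = r - t := Nat.cast_sub (by omega)
        have e : (r : ℝ) - l = ((r : ℝ) - t - l) + t := by ring
        have h4 : (l : ℝ) + t + t ≤ r := by
          have : l + t + t ≤ r := by omega
          exact_mod_cast this
        rw [← hr, e0, e, sub_sub_cancel]
        exact half_mul_le (Nat.cast_nonneg t) (by linarith) le_rfl (Or.inr rfl))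
      rw [hdiff, hψ]
      dsimp only
      rw [abs_mul, ← mul_assoc, ← mul_assoc]
      exact mul_le_mul_of_nonneg_right (hw.trans (mul_le_mul_of_nonneg_left (le_abs_self _)
        (by positivity))) (abs_nonneg _)
    have h5 := sum_two_sided_le hψ0 hlc
    have h6 := sqrt_mul_sqrt_add_le
      (a := energy (√8 / ν) c (levels (r - l)) (fun i => entry v (l + i)))
      (b := ∑ i ∈ Finset.range c, entry f (l + i) ^ 2)
      (c := energy (√8 / ν) (r - l - c) (levels (r - l)) (fun i => entry v (r - 1 - i)))
      (d := ∑ i ∈ Finset.range (r - l - c), entry f (r - 1 - i) ^ 2)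
      (energy_nonneg _ _ _ _) (Finset.sum_nonneg fun _ _ => sq_nonneg _)
      (energy_nonneg _ _ _ _) (Finset.sum_nonneg fun _ _ => sq_nonneg _)
    rw [sum_Ico_two_sided _ hlc, hB, hA]
    dsimp only
    rw [← hr, ← hc, sum_Ico_two_sided _ hlc]
    linarith
  have hsum := Finset.sum_le_sum hblock
  rw [← sum_blocks hS hn fun k => entry v k * entry f k, sum_Icc_entry v f fun x y => x * y,
    Finset.sum_add_distrib, ← sum_block_interiors hS hn ψ] at hsum
  have hCS := Real.sum_sqrt_mul_sqrt_le (insert 1 S) (f := A) (g := B)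
    (fun l => add_nonneg (energy_nonneg _ _ _ _) (energy_nonneg _ _ _ _))
    (fun l => Finset.sum_nonneg fun _ _ => sq_nonneg _)
  have hBs : ∑ l ∈ insert 1 S, B l = ∑ i, f i ^ 2 := by
    rw [hB, ← sum_blocks hS hn fun k => entry f k ^ 2, sum_Icc_entry f f fun _ y => y ^ 2]
  have hψs : ∑ k ∈ Finset.Icc 2 n \ S, ψ k = n * lam * weightedTV S f := by
    rw [hψ, weightedTV, Finset.mul_sum]
  rw [hBs] at hCS
  rw [hψs] at hsum
  exact hsum.trans (add_le_add_left hCS _)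

end Total

section Expectation

variable {Ω : Type*} [MeasurableSpace Ω] {P : Measure Ω} [IsProbabilityMeasure P] {n : ℕ}
  {Y : Fin n → Ω → ℝ} {S : Finset ℕ}

/-- The linear map that reads the entries of a vector in the order given by `σ`. -/
def reindex (n : ℕ) (σ : ℕ → ℕ) : (Fin n → ℝ) →ₗ[ℝ] (ℕ → ℝ) where
  toFun v i := entry v (σ i)
  map_add' v w := funext fun i => entry_add v w (σ i)
  map_smul' r v := funext fun i => entry_smul r v (σ i)

lemma integral_totalEnergy_le (hm : ∀ i, Measurable (Y i)) (h01 : ∀ i ω, Y i ω = 0 ∨ Y i ω = 1)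
    (hI : iIndepFun Y P) (hS : S ⊆ Finset.Icc 2 n) (hn : 0 < n) {T : ℝ} (hT : 0 < T) :
    ∫ ω, totalEnergy T n S (fun i => noise P Y i ω) ∂P ≤
      ∑ l ∈ insert 1 S, (0.54 + 244 / T ^ 2 * levels (rightEnd n S l - l)) := by
  have hint : ∀ h : (Fin n → ℝ) → ℝ, Integrable (fun ω => h fun i => noise P Y i ω) P :=
    integrable_comp_noise hm h01
  unfold totalEnergy
  rw [integral_finsetSum _ fun l _ => hint fun v =>
    energy T ((rightEnd n S l - l + 1) / 2) (levels (rightEnd n S l - l))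
        (fun i => entry v (l + i)) +
      energy T (rightEnd n S l - l - (rightEnd n S l - l + 1) / 2) (levels (rightEnd n S l - l))
        (fun i => entry v (rightEnd n S l - 1 - i))]
  refine Finset.sum_le_sum fun l hl => ?_
  have hb := block_bounds hS hn hl
  set r := rightEnd n S l
  set c := (r - l + 1) / 2 with hc
  have hlc : l + c ≤ r := by omega
  have hsub : ∀ v : Fin n → ℝ, ∑ i ∈ Finset.range c, entry v (l + i) ^ 2 +
      ∑ i ∈ Finset.range (r - l - c), entry v (r - 1 - i) ^ 2 ≤ ∑ i, v i ^ 2 := by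
    intro v
    rw [← sum_Ico_two_sided (fun k => entry v k ^ 2) hlc, ← sum_Icc_entry v v fun _ y => y ^ 2]
    refine Finset.sum_le_sum_of_subset_of_nonneg ?_ fun _ _ _ => sq_nonneg _
    intro k hk
    have := Finset.mem_Ico.1 hk
    exact Finset.mem_Icc.2 (by omega)
  rw [integral_add (hint fun v => energy T c (levels (r - l)) fun i => entry v (l + i))
    (hint fun v => energy T (r - l - c) (levels (r - l)) fun i => entry v (r - 1 - i))]
  have h1 := integral_energy_le (P := P) hm h01 hI hT c (levels (r - l))
    (reindex n fun i => l + i) fun v => by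
      have h2 : 0 ≤ ∑ i ∈ Finset.range (r - l - c), entry v (r - 1 - i) ^ 2 :=
        Finset.sum_nonneg fun _ _ => sq_nonneg _
      have := hsub v
      change ∑ i ∈ Finset.range c, entry v (l + i) ^ 2 ≤ _
      linarith
  have h2 := integral_energy_le (P := P) hm h01 hI hT (r - l - c) (levels (r - l))
    (reindex n fun i => r - 1 - i) fun v => by
      have h2 : 0 ≤ ∑ i ∈ Finset.range c, entry v (l + i) ^ 2 :=
        Finset.sum_nonneg fun _ _ => sq_nonneg _
      have := hsub v
      change ∑ i ∈ Finset.range (r - l - c), entry v (r - 1 - i) ^ 2 ≤ _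
      linarith
  refine (add_le_add h1 h2).trans (le_of_eq ?_)
  ring

/-- The weights at the jumps contribute `1` each to `‖w⁻¹‖²`, and the other weights of a block a
harmonic sum. -/
lemma card_add_levels_le (hS : S ⊆ Finset.Icc 2 n) (hn : 0 < n) :
    (S.card : ℝ) + 1.386 * ∑ l ∈ insert 1 S, (levels (rightEnd n S l - l) : ℝ) ≤
      invWeightNorm n S ^ 2 := by
  have hn' : (0 : ℝ) < n := by exact_mod_cast hn
  rw [invWeightNorm, Real.sq_sqrt (by positivity), Finset.sum_div,
    ← Finset.sum_sdiff hS, add_comm]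
  refine add_le_add ?_ ?_
  · rw [sum_block_interiors hS hn, Finset.mul_sum]
    refine Finset.sum_le_sum fun l hl => ?_
    have hb := block_bounds hS hn hl
    refine (levels_le_sum hb.2.1).trans (Finset.sum_le_sum fun k hk => ?_)
    obtain ⟨h1, h2⟩ := Finset.mem_Ioo.1 hk
    have h1' : (l : ℝ) < k := by exact_mod_cast h1
    have h2' : (k : ℝ) < rightEnd n S l := by exact_mod_cast h2
    have e1 : (0 : ℝ) < k - l := by linarith
    have e2 : (0 : ℝ) < rightEnd n S l - k := by linarith
    have e3 : (0 : ℝ) < rightEnd n S l - l := by linarith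
    rw [weight_eq hS hn hl h1 h2, div_pow, Real.sq_sqrt (by positivity)]
    refine le_of_eq ?_
    field_simp
    ring
  · refine le_of_eq ?_
    rw [Finset.sum_congr rfl (g := fun _ => (1 : ℝ)), Finset.sum_const, nsmul_eq_mul, mul_one]
    intro k hk
    rw [weight, if_pos hk, div_pow, Real.sq_sqrt (by positivity)]
    field_simp

end Expectation

/-! ### The penalized supremum -/

section PenSup

variable {n : ℕ}

/-- The supremum of `⟨v, f⟩ - N f` over the Euclidean unit ball, for a penalty `N`. -/
noncomputable def penSup (N : (Fin n → ℝ) → ℝ) (v : Fin n → ℝ) : ℝ :=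
  ⨆ f : {f : Fin n → ℝ // ∑ i, f i ^ 2 ≤ 1}, (∑ i, v i * f.1 i - N f.1)

instance : Nonempty {f : Fin n → ℝ // ∑ i, f i ^ 2 ≤ 1} := ⟨⟨0, by simp⟩⟩

lemma sum_mul_le_sqrt_of_mem_ball (v : Fin n → ℝ) {f : Fin n → ℝ} (hf : ∑ i, f i ^ 2 ≤ 1) :
    ∑ i, v i * f i ≤ √(∑ i, v i ^ 2) := by
  refine (Real.sum_mul_le_sqrt_mul_sqrt _ _ _).trans ?_
  exact mul_le_of_le_one_right (Real.sqrt_nonneg _) (Real.sqrt_le_one.2 hf)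

variable {N : (Fin n → ℝ) → ℝ}

lemma penSup_bddAbove (hN : ∀ f, 0 ≤ N f) (v : Fin n → ℝ) :
    BddAbove (Set.range fun f : {f : Fin n → ℝ // ∑ i, f i ^ 2 ≤ 1} =>
      ∑ i, v i * f.1 i - N f.1) := by
  refine ⟨√(∑ i, v i ^ 2), ?_⟩
  rintro _ ⟨f, rfl⟩
  have := sum_mul_le_sqrt_of_mem_ball v f.2
  have := hN f.1
  dsimp only
  linarith

lemma le_penSup (hN : ∀ f, 0 ≤ N f) (v : Fin n → ℝ) {f : Fin n → ℝ} (hf : ∑ i, f i ^ 2 ≤ 1) :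
    ∑ i, v i * f i - N f ≤ penSup N v :=
  le_ciSup (penSup_bddAbove hN v) ⟨f, hf⟩

lemma penSup_nonneg (hN : ∀ f, 0 ≤ N f) (hN0 : N 0 = 0) (v : Fin n → ℝ) : 0 ≤ penSup N v := by
  simpa [hN0] using le_penSup hN v (f := 0) (by simp)

lemma convexOn_penSup (hN : ∀ f, 0 ≤ N f) : ConvexOn ℝ Set.univ (penSup N) := by
  refine ⟨convex_univ, fun v _ w _ a b ha hb hab => ciSup_le fun f => ?_⟩
  have h1 := mul_le_mul_of_nonneg_left (le_penSup hN v f.2) ha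
  have h2 := mul_le_mul_of_nonneg_left (le_penSup hN w f.2) hb
  have h3 : ∑ i, (a • v + b • w) i * f.1 i = a * ∑ i, v i * f.1 i + b * ∑ i, w i * f.1 i := by
    rw [Finset.mul_sum, Finset.mul_sum, ← Finset.sum_add_distrib]
    refine Finset.sum_congr rfl fun i _ => ?_
    simp only [Pi.add_apply, Pi.smul_apply, smul_eq_mul]
    ring
  have h4 : N f.1 = a * N f.1 + b * N f.1 := by rw [← add_mul, hab, one_mul]
  rw [h3, smul_eq_mul, smul_eq_mul]
  linarith

lemma penSup_lipschitz (hN : ∀ f, 0 ≤ N f) (v w : Fin n → ℝ) :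
    penSup N v ≤ penSup N w + √(∑ i, (v i - w i) ^ 2) := by
  refine ciSup_le fun f => ?_
  have h1 := le_penSup hN w f.2
  have h2 := sum_mul_le_sqrt_of_mem_ball (fun i => v i - w i) f.2
  have h3 : ∑ i, v i * f.1 i = ∑ i, w i * f.1 i + ∑ i, (v i - w i) * f.1 i := by
    rw [← Finset.sum_add_distrib]
    exact Finset.sum_congr rfl fun i _ => by ring
  linarith

lemma sum_mul_le_penSup (hN : ∀ f, 0 ≤ N f) (hNs : ∀ (r : ℝ) f, N (r • f) = |r| * N f)
    (v f : Fin n → ℝ) : ∑ i, v i * f i ≤ penSup N v * √(∑ i, f i ^ 2) + N f := by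
  set R := √(∑ i, f i ^ 2) with hR
  have hR2 : R ^ 2 = ∑ i, f i ^ 2 := Real.sq_sqrt (Finset.sum_nonneg fun _ _ => sq_nonneg _)
  rcases (Real.sqrt_nonneg (∑ i, f i ^ 2)).eq_or_lt with h | h
  · have h0 : ∀ i, f i = 0 := by
      have : ∑ i, f i ^ 2 = 0 := by rw [← hR2, hR, ← h]; norm_num
      intro i
      have := (Finset.sum_eq_zero_iff_of_nonneg fun i _ => sq_nonneg (f i)).1 this i
        (Finset.mem_univ i)
      exact pow_eq_zero_iff (two_ne_zero) |>.1 this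
    rw [hR, ← h, mul_zero, zero_add]
    simpa [h0] using hN f
  · have hR0 : 0 < R := h
    have h1 := le_penSup hN v (f := R⁻¹ • f) (by
      simp only [Pi.smul_apply, smul_eq_mul, mul_pow, ← Finset.mul_sum]
      rw [← hR2, ← mul_pow, inv_mul_cancel₀ hR0.ne', one_pow])
    rw [hNs, abs_of_pos (inv_pos.2 hR0)] at h1
    have h2 : ∑ i, v i * (R⁻¹ • f) i = R⁻¹ * ∑ i, v i * f i := by
      rw [Finset.mul_sum]
      exact Finset.sum_congr rfl fun i _ => by rw [Pi.smul_apply, smul_eq_mul]; ring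
    rw [h2, ← mul_sub, inv_mul_le_iff₀ hR0] at h1
    linarith

end PenSup

lemma weightedTV_nonneg {n : ℕ} (S : Finset ℕ) (f : Fin n → ℝ) : 0 ≤ weightedTV S f :=
  Finset.sum_nonneg fun _ _ => abs_nonneg _

lemma weightedTV_smul {n : ℕ} (S : Finset ℕ) (r : ℝ) (f : Fin n → ℝ) :
    weightedTV S (r • f) = |r| * weightedTV S f := by
  unfold weightedTV
  rw [Finset.mul_sum]
  refine Finset.sum_congr rfl fun k _ => ?_
  rw [← abs_mul]
  congr 1
  rw [diff, diff, entry_smul, entry_smul]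
  ring

/-- The comparison of the bound that comes from the total energy with `δ_n²(t)`. The number `J` of
dyadic levels and the number `s` of jumps are both controlled by `W = ‖w⁻¹‖`. -/
lemma energy_numeric {A₀ ν W L t s J Q : ℝ} (hA : 5 / 8 ≤ A₀) (hν : 0 < ν) (hW0 : 0 ≤ W)
    (hs : 0 ≤ s) (hJ : 0 ≤ J) (hW : s + 1.386 * J ≤ W ^ 2) (hL : 1 + t ≤ L) (ht : 0 < t)
    (hQ0 : 0 ≤ Q) (hQ : Q ≤ 0.54 * (s + 1) + 30.5 * ν ^ 2 * J) :
    (√Q + 2 * √t) ^ 2 ≤ 4 * ((4 * ν * A₀ * W + 8 * √L) ^ 2 + 2 * s / ν) := by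
  have hL0 : 0 ≤ L := by linarith
  have h1 : √Q ^ 2 = Q := Real.sq_sqrt hQ0
  have h2 : √t ^ 2 = t := Real.sq_sqrt ht.le
  have h3 : √L ^ 2 = L := Real.sq_sqrt hL0
  have h4 : (√Q + 2 * √t) ^ 2 ≤ 16 / 15 * Q + 64 * t := by
    have := sq_nonneg (√Q - 30 * √t)
    linarith
  have h5 : 16 * ν ^ 2 * (25 / 64) * (s + 1.386 * J) + 64 * L ≤ (4 * ν * A₀ * W + 8 * √L) ^ 2 := by
    have e : (4 * ν * A₀ * W + 8 * √L) ^ 2 =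
        16 * ν ^ 2 * A₀ ^ 2 * W ^ 2 + 64 * (ν * A₀ * W * √L) + 64 * √L ^ 2 := by ring
    rw [e, h3]
    have e1 : 0 ≤ ν * A₀ * W * √L := by positivity
    have e2 : (25 / 64 : ℝ) ≤ A₀ ^ 2 := by nlinarith
    have e3 : 16 * ν ^ 2 * (25 / 64) * (s + 1.386 * J) ≤ 16 * ν ^ 2 * A₀ ^ 2 * W ^ 2 := by
      gcongr
    linarith
  -- Either the jump term or the entropy term pays for the means of the blocks.
  have h6 : 0.576 * s ≤ 25 * ν ^ 2 * s + 8 * s / ν := by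
    rcases le_total ν 1 with h | h
    · have : 8 * s ≤ 8 * s / ν := by
        rw [le_div_iff₀ hν]; nlinarith
      nlinarith [mul_nonneg (sq_nonneg ν) hs]
    · have e1 : 0 ≤ 8 * s / ν := by positivity
      have e2 : 1 ≤ ν ^ 2 := by nlinarith
      nlinarith [mul_le_mul_of_nonneg_right e2 hs]
  have h7 : 0 ≤ ν ^ 2 * J := by positivity
  have h8 : 4 * (2 * s / ν) = 8 * s / ν := by ring
  linarith

lemma sq_le_mul_deltaSqBound {A₀ ν t : ℝ} {n : ℕ} (hn : 0 < n) (S : Finset ℕ) (hν : 0 < ν) :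
    (4 * ν * A₀ * invWeightNorm n S + 8 * √(confidence n t)) ^ 2 + 2 * S.card / ν ≤
      n * deltaSqBound A₀ ν n S t := by
  have hn' : (0 : ℝ) < n := by exact_mod_cast hn
  have hsn : √(n : ℝ) ^ 2 = n := Real.sq_sqrt hn'.le
  have hsn0 : 0 < √(n : ℝ) := Real.sqrt_pos.2 hn'
  unfold deltaSqBound
  rw [mul_add]
  refine add_le_add (le_of_eq ?_) ?_
  · rw [Real.sqrt_div' _ hn'.le]
    rw [← mul_div_assoc, ← add_div, div_pow, hsn, mul_div_cancel₀ _ hn'.ne']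
  · have h1 : (2 * √((S.card : ℝ) / n)) ^ 2 ≤
        (diffWeightNorm n S + 2 * √((S.card : ℝ) / n)) ^ 2 := by
      have : 0 ≤ diffWeightNorm n S := Real.sqrt_nonneg _
      have : 0 ≤ √((S.card : ℝ) / n) := Real.sqrt_nonneg _
      exact pow_le_pow_left₀ (by positivity) (by linarith) 2
    rw [mul_pow, Real.sq_sqrt (by positivity)] at h1
    have h2 : 1 / (2 * ν) ≤ 1 / (2 * ν) + 4 * √((A₀ * invWeightNorm n S / √n) / n) +
        4 * √(confidence n t) / n := by
      have e1 : 0 ≤ 4 * √((A₀ * invWeightNorm n S / √n) / n) := by positivity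
      have e2 : 0 ≤ 4 * √(confidence n t) / n := by positivity
      linarith
    have h3 := mul_le_mul h2 h1 (by positivity) (le_trans (by positivity) h2)
    have h4 := mul_le_mul_of_nonneg_left h3 hn'.le
    refine le_trans (le_of_eq ?_) h4
    field_simp

/-- The uniform bound for the noise, for every constant `A₀ ≥ 5/8`. -/
theorem noise_bound {A₀ : ℝ} (hA : 5 / 8 ≤ A₀) {Ω : Type*} [MeasurableSpace Ω] {P : Measure Ω}
    [IsProbabilityMeasure P] {n : ℕ} (hn : 0 < n) {Y : Fin n → Ω → ℝ} (hm : ∀ i, Measurable (Y i))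
    (h01 : ∀ i ω, Y i ω = 0 ∨ Y i ω = 1) (hI : iIndepFun Y P) {S : Finset ℕ}
    (hS : S ⊆ Finset.Icc 2 n) {ν μ t : ℝ} (hν : 0 < ν) (hμ : 0 < μ) (ht : 0 < t) {δsq lam : ℝ}
    (hδ : deltaSqBound A₀ ν n S t ≤ δsq) (hlam : lambdaBound A₀ ν n S t ≤ lam) :
    1 - Real.exp (-t) ≤ P.real {ω | ∀ f : Fin n → ℝ,
      (∑ i, noise P Y i ω * f i) / n ≤
        μ * δsq + normQnSq f / μ + lam * weightedTV S f} := by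
  have hn' : (0 : ℝ) < n := by exact_mod_cast hn
  have hlam1 : 4 / ν / √n ≤ lam := by
    refine le_trans ?_ hlam
    unfold lambdaBound
    rw [div_eq_mul_one_div (4 / ν), mul_comm]
    refine mul_le_mul_of_nonneg_left ?_ (by positivity)
    have e1 : 0 ≤ 8 * √((A₀ * invWeightNorm n S / √n) / n) := by positivity
    have e2 : 0 ≤ 8 * √(confidence n t) / n := by positivity
    linarith
  have hlam0 : 0 ≤ lam := le_trans (by positivity) hlam1
  set N : (Fin n → ℝ) → ℝ := fun f => n * lam * weightedTV S f with hN
  have hN0 : ∀ f, 0 ≤ N f := fun f => by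
    have := weightedTV_nonneg S f
    positivity
  have hNs : ∀ (r : ℝ) f, N (r • f) = |r| * N f := fun r f => by
    rw [hN]
    dsimp only
    rw [weightedTV_smul]
    ring
  have hNz : N 0 = 0 := by simpa using hNs 0 0
  set m : Fin n → ℝ := fun i => ∫ ω', Y i ω' ∂P with hmean
  have hconv : ConvexOn ℝ Set.univ fun y : Fin n → ℝ => penSup N (fun i => y i - m i) := by
    have := (convexOn_penSup hN0).translate_left (-m)
    simp only [Set.preimage_univ, Function.comp_def, ← sub_eq_add_neg] at this
    exact this
  have hconc := convex_lipschitz_concentration (P := P) hm h01 hI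
    (V := fun y => penSup N fun i => y i - m i)
    (fun y => penSup_nonneg hN0 hNz _) hconv
    (fun x y => by simpa using penSup_lipschitz hN0 (fun i => x i - m i) fun i => y i - m i) ht
  refine hconc.trans (measureReal_mono fun ω hω f => ?_)
  set T : ℝ := √8 / ν with hT
  have hT0 : 0 < T := by positivity
  have hT2 : T ^ 2 = 8 / ν ^ 2 := by rw [hT, div_pow, Real.sq_sqrt (by norm_num)]
  have hint : ∀ h : (Fin n → ℝ) → ℝ, Integrable (fun ω => h fun i => noise P Y i ω) P :=
    integrable_comp_noise hm h01
  set Q := ∫ ω, totalEnergy T n S (fun i => noise P Y i ω) ∂P with hQ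
  have hQ0 : 0 ≤ Q := integral_nonneg fun ω => totalEnergy_nonneg T _
  have hpen : ∀ v, penSup N v ≤ √(totalEnergy T n S v) := fun v => ciSup_le fun g => by
    have h1 := sum_mul_le_totalEnergy hS hn hν hlam1 v g.1
    have h2 : √(totalEnergy T n S v) * √(∑ i, g.1 i ^ 2) ≤ √(totalEnergy T n S v) :=
      mul_le_of_le_one_right (Real.sqrt_nonneg _) (Real.sqrt_le_one.2 g.2)
    rw [hN]
    dsimp only
    linarith
  have hEV : ∫ ω', penSup N (fun i => Y i ω' - m i) ∂P ≤ √Q := by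
    have h1 : ∫ ω', penSup N (fun i => Y i ω' - m i) ∂P ≤
        ∫ ω', √(totalEnergy T n S fun i => noise P Y i ω') ∂P :=
      integral_mono (hint fun v => penSup N v) (hint fun v => √(totalEnergy T n S v))
        fun ω' => hpen _
    refine h1.trans ?_
    apply Real.le_sqrt_of_sq_le
    have h2 := (convexOn_pow (𝕜 := ℝ) 2).map_integral_le (μ := P)
      (f := fun ω' => √(totalEnergy T n S fun i => noise P Y i ω'))
      (continuous_pow 2).continuousOn isClosed_Ici
      (Filter.Eventually.of_forall fun ω' => Real.sqrt_nonneg _)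
      (hint fun v => √(totalEnergy T n S v)) (hint fun v => √(totalEnergy T n S v) ^ 2)
    refine h2.trans (le_of_eq ?_)
    exact integral_congr_ae (Filter.Eventually.of_forall fun ω' =>
      Real.sq_sqrt (totalEnergy_nonneg T _))
  have h1S : 1 ∉ S := fun h => by have := Finset.mem_Icc.1 (hS h); omega
  have hQle : Q ≤ 0.54 * (S.card + 1) +
      30.5 * ν ^ 2 * ∑ l ∈ insert 1 S, (levels (rightEnd n S l - l) : ℝ) := by
    refine (integral_totalEnergy_le hm h01 hI hS hn hT0).trans (le_of_eq ?_)
    rw [Finset.sum_add_distrib, ← Finset.mul_sum, Finset.sum_const, Finset.card_insert_of_notMem h1S,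
      hT2, nsmul_eq_mul]
    push_cast
    field_simp
    ring
  have hL : 1 + t ≤ confidence n t := by
    unfold confidence
    have h1 : 0 ≤ Real.logb 2 n :=
      Real.logb_nonneg (by norm_num) (by exact_mod_cast hn)
    have := Real.log_nonneg (show (1 : ℝ) ≤ 3 + 2 * Real.logb 2 n by linarith)
    linarith
  have hnum := energy_numeric hA hν (Real.sqrt_nonneg _) (Nat.cast_nonneg S.card)
    (Finset.sum_nonneg fun l _ => Nat.cast_nonneg _) (card_add_levels_le hS hn) hL ht hQ0 hQle
  have hδ2 : (√Q + 2 * √t) ^ 2 ≤ 4 * (n * δsq) := by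
    refine hnum.trans (mul_le_mul_of_nonneg_left ?_ (by norm_num))
    exact (sq_le_mul_deltaSqBound hn S hν).trans (mul_le_mul_of_nonneg_left hδ hn'.le)
  have hω' : penSup N (fun i => noise P Y i ω) ≤ √Q + 2 * √t :=
    (show penSup N (fun i => Y i ω - m i) ≤ _ from hω).trans (by linarith)
  have hfin := sum_mul_le_penSup hN0 hNs (fun i => noise P Y i ω) f
  set R := √(∑ i, f i ^ 2) with hR
  have hR2 : R ^ 2 = ∑ i, f i ^ 2 := Real.sq_sqrt (Finset.sum_nonneg fun _ _ => sq_nonneg _)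
  have hR0 : 0 ≤ R := Real.sqrt_nonneg _
  set b := √Q + 2 * √t with hb
  have h3 : ∑ i, noise P Y i ω * f i ≤ b * R + n * lam * weightedTV S f :=
    hfin.trans (by gcongr)
  have h4 : b * R ≤ n * (μ * δsq) + R ^ 2 / μ := by
    have h5 : b * R ≤ μ * b ^ 2 / 4 + R ^ 2 / μ := by
      have : μ * b ^ 2 / 4 + R ^ 2 / μ - b * R = μ * (b / 2 - R / μ) ^ 2 := by
        field_simp
        ring
      have := mul_nonneg hμ.le (sq_nonneg (b / 2 - R / μ))
      linarith
    have h6 := mul_le_mul_of_nonneg_left hδ2 hμ.le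
    linarith
  rw [div_le_iff₀ hn', normQnSq, ← hR2]
  have h6 : (μ * δsq + R ^ 2 / n / μ + lam * weightedTV S f) * n =
      n * (μ * δsq) + R ^ 2 / μ + n * lam * weightedTV S f := by
    field_simp
  linarith

/-! ### Entropy of vectors of bounded variation -/

/-- The number of classes of a partition into sets of diameter at most `u` bounds the covering
number. -/
lemma coveringNumber_le_card {E ι : Type*} {d : E → E → ℝ} {V : Set E} {u : ℝ}
    (Φ : E → ι) (T : Finset ι) (hT : ∀ g ∈ V, Φ g ∈ T)
    (hd : ∀ g ∈ V, ∀ h ∈ V, Φ g = Φ h → d g h ≤ u) : coveringNumber d V u ≤ (T.card : ℕ∞) := by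
  classical
  set T' := T.filter fun i => ∃ g ∈ V, Φ g = i with hT'
  have hc : ∀ i : T', ∃ g ∈ V, Φ g = i.1 := fun i => (Finset.mem_filter.1 i.2).2
  choose ρ hρV hρ using hc
  have h1 : coveringNumber d V u ≤ ((Finset.univ.image ρ).card : ℕ∞) := by
    refine iInf₂_le _ ⟨?_, ?_⟩
    · intro g hg
      obtain ⟨i, -, rfl⟩ := Finset.mem_image.1 (Finset.mem_coe.1 hg)
      exact hρV i
    · intro v hv
      have hi : Φ v ∈ T' := Finset.mem_filter.2 ⟨hT v hv, v, hv, rfl⟩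
      refine ⟨ρ ⟨Φ v, hi⟩, Finset.mem_image_of_mem _ (Finset.mem_univ _), ?_⟩
      exact hd v hv _ (hρV _) (hρ ⟨Φ v, hi⟩).symm
  refine h1.trans ?_
  have h2 : (Finset.univ.image ρ).card ≤ T.card := by
    refine Finset.card_image_le.trans ?_
    rw [Finset.card_univ, Fintype.card_coe]
    exact Finset.card_filter_le _ _
  exact_mod_cast h2

/-- The mass that the weights `q` give to the sublevel set `{p < y}`. -/
noncomputable def sublevelMass {m : ℕ} (q p : Fin m → ℝ) (y : ℝ) : ℝ :=
  ∑ x with p x < y, q x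

/-- The `i`-th code of `p` at resolution `2⁻ʳ`: the masses of the sublevel sets at the multiples of
`2ⁱ⁻ʳ`, rounded to multiples of `2⁻ʳ⁻²ⁱ`. This nondecreasing sequence of integers is recorded as a
set, after it has been made strictly increasing by the addition of the index. -/
noncomputable def code {m : ℕ} (r : ℕ) (q p : Fin m → ℝ) (i : ℕ) : Finset ℕ :=
  Finset.univ.image fun v : Fin (2 ^ (r - i)) =>
    ⌊(2 : ℝ) ^ (r + 2 * i) * sublevelMass q p (((v : ℕ) + 1) / 2 ^ (r - i))⌋₊ + v

section Code

variable {m : ℕ} {q : Fin m → ℝ}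

lemma sublevelMass_mono (hq : ∀ x, 0 ≤ q x) (p : Fin m → ℝ) {y z : ℝ} (h : y ≤ z) :
    sublevelMass q p y ≤ sublevelMass q p z :=
  Finset.sum_le_sum_of_subset_of_nonneg
    (fun x hx => by
      rw [Finset.mem_filter] at hx ⊢
      exact ⟨hx.1, hx.2.trans_le h⟩) fun x _ _ => hq x

lemma sublevelMass_nonneg (hq : ∀ x, 0 ≤ q x) (p : Fin m → ℝ) (y : ℝ) : 0 ≤ sublevelMass q p y :=
  Finset.sum_nonneg fun x _ => hq x

lemma sublevelMass_le_one (hq : ∀ x, 0 ≤ q x) (hq1 : ∑ x, q x ≤ 1) (p : Fin m → ℝ) (y : ℝ) :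
    sublevelMass q p y ≤ 1 :=
  (Finset.sum_le_sum_of_subset_of_nonneg (Finset.filter_subset _ _) fun x _ _ => hq x).trans hq1

lemma strictMono_code (hq : ∀ x, 0 ≤ q x) (p : Fin m → ℝ) (r i : ℕ) :
    StrictMono fun v : Fin (2 ^ (r - i)) =>
      ⌊(2 : ℝ) ^ (r + 2 * i) * sublevelMass q p (((v : ℕ) + 1) / 2 ^ (r - i))⌋₊ + (v : ℕ) := by
  intro v w hvw
  refine add_lt_add_of_le_of_lt (Nat.floor_mono ?_) hvw
  refine mul_le_mul_of_nonneg_left (sublevelMass_mono hq p ?_) (by positivity)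
  have : ((v : ℕ) : ℝ) ≤ (w : ℕ) := by exact_mod_cast hvw.le
  gcongr

lemma card_code (hq : ∀ x, 0 ≤ q x) (p : Fin m → ℝ) (r i : ℕ) :
    (code r q p i).card = 2 ^ (r - i) := by
  rw [code, Finset.card_image_of_injective _ (strictMono_code hq p r i).injective, Finset.card_univ,
    Fintype.card_fin]

lemma code_mem (hq : ∀ x, 0 ≤ q x) (hq1 : ∑ x, q x ≤ 1) (p : Fin m → ℝ) (r i : ℕ) :
    code r q p i ∈ Finset.powersetCard (2 ^ (r - i))
      (Finset.range (2 ^ (r + 2 * i) + 2 ^ (r - i))) := by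
  rw [Finset.mem_powersetCard]
  refine ⟨?_, card_code hq p r i⟩
  intro k hk
  obtain ⟨v, -, rfl⟩ := Finset.mem_image.1 hk
  rw [Finset.mem_range]
  refine add_lt_add_of_le_of_lt ?_ v.2
  refine Nat.floor_le_of_le ?_
  have := sublevelMass_le_one hq hq1 p (((v : ℕ) + 1) / 2 ^ (r - i))
  push_cast
  exact mul_le_of_le_one_right (by positivity) this

lemma abs_sublevelMass_sub_le (hq : ∀ x, 0 ≤ q x) {p p' : Fin m → ℝ} {r i : ℕ}
    (h : code r q p i = code r q p' i) (v : Fin (2 ^ (r - i))) :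
    |sublevelMass q p (((v : ℕ) + 1) / 2 ^ (r - i)) -
      sublevelMass q p' (((v : ℕ) + 1) / 2 ^ (r - i))| ≤ 1 / 2 ^ (r + 2 * i) := by
  have h1 := Finset.orderEmbOfFin_unique (card_code hq p' r i)
    (fun x => h ▸ Finset.mem_image_of_mem _ (Finset.mem_univ x)) (strictMono_code hq p r i)
  have h2 := Finset.orderEmbOfFin_unique (card_code hq p' r i)
    (fun x => Finset.mem_image_of_mem _ (Finset.mem_univ x)) (strictMono_code hq p' r i)
  have h3 := congrFun (h1.trans h2.symm) v
  have h4 := Nat.add_right_cancel h3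
  set K : ℝ := 2 ^ (r + 2 * i) with hK
  have hK0 : 0 < K := by positivity
  have h5 : |K * sublevelMass q p (((v : ℕ) + 1) / 2 ^ (r - i)) -
      K * sublevelMass q p' (((v : ℕ) + 1) / 2 ^ (r - i))| ≤ 1 := by
    have e1 := Nat.floor_le (mul_nonneg hK0.le
      (sublevelMass_nonneg hq p (((v : ℕ) + 1) / 2 ^ (r - i))))
    have e2 := Nat.lt_floor_add_one (K * sublevelMass q p (((v : ℕ) + 1) / 2 ^ (r - i)))
    have e3 := Nat.floor_le (mul_nonneg hK0.le
      (sublevelMass_nonneg hq p' (((v : ℕ) + 1) / 2 ^ (r - i))))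
    have e4 := Nat.lt_floor_add_one (K * sublevelMass q p' (((v : ℕ) + 1) / 2 ^ (r - i)))
    rw [h4] at e1 e2
    rw [abs_le]
    constructor <;> linarith
  rw [← mul_sub, abs_mul, abs_of_pos hK0] at h5
  rwa [le_div_iff₀' hK0]

/-- Sublevel sets of monotone functions are nested, so that their symmetric difference has the mass
`|F - F'|`. -/
lemma sum_symmDiff_le (hq : ∀ x, 0 ≤ q x) {p p' : Fin m → ℝ} (hp : Monotone p) (hp' : Monotone p')
    (y : ℝ) : ∑ x with ¬ (p x < y ↔ p' x < y), q x ≤ |sublevelMass q p y - sublevelMass q p' y| := by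
  have key : ∀ p p' : Fin m → ℝ, (∀ x, p x < y → p' x < y) →
      ∑ x with ¬ (p x < y ↔ p' x < y), q x ≤ sublevelMass q p' y - sublevelMass q p y := by
    intro p p' hpp
    unfold sublevelMass
    rw [le_sub_iff_add_le, ← Finset.sum_union]
    · refine Finset.sum_le_sum_of_subset_of_nonneg ?_ fun x _ _ => hq x
      intro x hx
      have := hpp x
      simp only [Finset.mem_union, Finset.mem_filter, Finset.mem_univ, true_and] at hx ⊢
      tauto
    · rw [Finset.disjoint_left]
      intro x hx hx'
      have := hpp x
      simp only [Finset.mem_filter, Finset.mem_univ, true_and] at hx hx'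
      tauto
  have hnest : (∀ x, p x < y → p' x < y) ∨ ∀ x, p' x < y → p x < y := by
    by_contra! h
    obtain ⟨⟨x, hx1, hx2⟩, z, hz1, hz2⟩ := h
    rcases le_total x z with h | h
    · exact absurd (hx2.trans (hp' h)) (not_le.2 hz1)
    · exact absurd (hz2.trans (hp h)) (not_le.2 hx1)
  rcases hnest with h | h
  · refine (key p p' h).trans ?_
    rw [abs_sub_comm]
    exact le_abs_self _
  · refine le_trans (le_of_eq ?_) ((key p' p h).trans (le_abs_self _))
    exact Finset.sum_congr (Finset.filter_congr fun x _ => by tauto) fun _ _ => rfl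

/-- Functions with the same `i`-th code differ by `2ⁱ⁻ʳ` or more only on a set of mass `8⁻ⁱ`: they
are separated there by one of `2ʳ⁻ⁱ` levels. -/
lemma sum_far_le (hq : ∀ x, 0 ≤ q x) {p p' : Fin m → ℝ} (hp : Monotone p)
    (hp' : Monotone p') (h0 : ∀ x, 0 ≤ p x) (h0' : ∀ x, 0 ≤ p' x) (h1 : ∀ x, p x ≤ 1)
    (h1' : ∀ x, p' x ≤ 1) {r i : ℕ} (hi : i ≤ r) (h : code r q p i = code r q p' i) :
    ∑ x with 1 / 2 ^ (r - i) ≤ |p x - p' x|, q x ≤ 1 / 8 ^ i := by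
  set M : ℝ := 2 ^ (r - i) with hM
  have hM0 : 0 < M := by positivity
  have hsep : ∀ a b : ℝ, 0 ≤ a → b ≤ 1 → 1 / M ≤ b - a →
      ∃ v : Fin (2 ^ (r - i)), a < ((v : ℕ) + 1) / M ∧ ((v : ℕ) + 1) / M ≤ b := by
    intro a b ha hb hab
    have hfl := Nat.floor_le (mul_nonneg hM0.le ha)
    have hfl' := Nat.lt_floor_add_one (M * a)
    have h2 : 1 ≤ M * b - M * a := by
      rw [div_le_iff₀' hM0] at hab; linarith
    have h3 : ⌊M * a⌋₊ < 2 ^ (r - i) := by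
      have : M * b ≤ M := mul_le_of_le_one_right hM0.le hb
      have e : ((2 ^ (r - i) : ℕ) : ℝ) = M := by rw [hM]; norm_num
      rw [← Nat.cast_lt (α := ℝ), e]
      linarith
    refine ⟨⟨_, h3⟩, ?_, ?_⟩
    · rw [lt_div_iff₀' hM0]; exact hfl'
    · rw [div_le_iff₀' hM0]; dsimp only; linarith
  calc ∑ x with 1 / M ≤ |p x - p' x|, q x
      ≤ ∑ x, ∑ v : Fin (2 ^ (r - i)),
        if ¬ (p x < ((v : ℕ) + 1) / M ↔ p' x < ((v : ℕ) + 1) / M) then q x else 0 := by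
        rw [Finset.sum_filter]
        refine Finset.sum_le_sum fun x _ => ?_
        have hnn : ∀ v ∈ (Finset.univ : Finset (Fin (2 ^ (r - i)))),
            0 ≤ if ¬ (p x < ((v : ℕ) + 1) / M ↔ p' x < ((v : ℕ) + 1) / M) then q x else 0 := by
          intro v _
          split_ifs <;> first | exact hq x | exact le_rfl
        split_ifs with hx
        · obtain ⟨v, hv⟩ : ∃ v : Fin (2 ^ (r - i)),
              ¬ (p x < ((v : ℕ) + 1) / M ↔ p' x < ((v : ℕ) + 1) / M) := by
            rcases le_total (p x) (p' x) with hle | hle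
            · rw [abs_of_nonpos (by linarith)] at hx
              obtain ⟨v, hv1, hv2⟩ := hsep (p x) (p' x) (h0 x) (h1' x) (by linarith)
              exact ⟨v, fun hh => absurd (hh.1 hv1) (not_lt.2 hv2)⟩
            · rw [abs_of_nonneg (by linarith)] at hx
              obtain ⟨v, hv1, hv2⟩ := hsep (p' x) (p x) (h0' x) (h1 x) (by linarith)
              exact ⟨v, fun hh => absurd (hh.2 hv1) (not_lt.2 hv2)⟩
          have := Finset.single_le_sum hnn (Finset.mem_univ v)
          rwa [if_pos hv] at this
        · exact Finset.sum_nonneg hnn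
    _ = ∑ v : Fin (2 ^ (r - i)),
        ∑ x with ¬ (p x < ((v : ℕ) + 1) / M ↔ p' x < ((v : ℕ) + 1) / M), q x := by
        rw [Finset.sum_comm]
        exact Finset.sum_congr rfl fun v _ => (Finset.sum_filter _ _).symm
    _ ≤ ∑ v : Fin (2 ^ (r - i)), 1 / (2 : ℝ) ^ (r + 2 * i) :=
        Finset.sum_le_sum fun v _ =>
          (sum_symmDiff_le hq hp hp' _).trans (abs_sublevelMass_sub_le hq h v)
    _ = 1 / 8 ^ i := by
        rw [Finset.sum_const, Finset.card_univ, Fintype.card_fin, nsmul_eq_mul]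
        obtain ⟨j, rfl⟩ := Nat.exists_eq_add_of_le hi
        have : (8 : ℝ) ^ i = 2 ^ (3 * i) := by rw [pow_mul]; norm_num
        rw [this, Nat.add_sub_cancel_left]
        push_cast
        rw [mul_one_div, div_eq_div_iff (by positivity) (by positivity), one_mul, ← pow_add]
        congr 1
        ring

lemma sq_le_layers {d : ℝ} (hd : 0 ≤ d) (r : ℕ) {j : ℕ} (hj : d ≤ 2 ^ j / 2 ^ r) :
    d ^ 2 ≤ 1 / 4 ^ r + ∑ i ∈ Finset.range j, if 2 ^ i / 2 ^ r ≤ d then 4 * 4 ^ i / 4 ^ r else 0 := by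
  have h4 : ∀ k : ℕ, (4 : ℝ) ^ k = (2 ^ k) ^ 2 := fun k => by
    rw [← pow_mul, mul_comm, pow_mul]; norm_num
  induction j with
  | zero =>
    have := pow_le_pow_left₀ hd hj 2
    simpa [h4, div_pow] using this
  | succ j ih =>
    rw [Finset.sum_range_succ]
    by_cases h : 2 ^ j / 2 ^ r ≤ d
    · have h1 : 0 ≤ ∑ i ∈ Finset.range j, if 2 ^ i / 2 ^ r ≤ d then 4 * (4 : ℝ) ^ i / 4 ^ r else 0 :=
        Finset.sum_nonneg fun i _ => by split_ifs <;> positivity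
      have h2 := pow_le_pow_left₀ hd hj 2
      rw [if_pos h]
      have h3 : ((2 : ℝ) ^ (j + 1) / 2 ^ r) ^ 2 = 4 * 4 ^ j / 4 ^ r := by
        rw [h4, h4, div_pow, pow_succ]; ring
      have h5 : (0 : ℝ) ≤ 1 / 4 ^ r := by positivity
      linarith
    · rw [if_neg h, add_zero]
      exact ih (not_le.1 h).le

/-- Monotone functions with the same codes are close in `L₂`. -/
lemma sum_sq_sub_le (hq : ∀ x, 0 ≤ q x) (hq1 : ∑ x, q x ≤ 1) {p p' : Fin m → ℝ}
    (hp : Monotone p) (hp' : Monotone p') (h0 : ∀ x, 0 ≤ p x) (h0' : ∀ x, 0 ≤ p' x)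
    (h1 : ∀ x, p x ≤ 1) (h1' : ∀ x, p' x ≤ 1) {r : ℕ}
    (h : ∀ i < r, code r q p i = code r q p' i) :
    ∑ x, q x * (p x - p' x) ^ 2 ≤ 9 / 4 ^ r := by
  have hpt : ∀ x, q x * (p x - p' x) ^ 2 ≤ q x * (1 / 4 ^ r) +
      ∑ i ∈ Finset.range r, (4 * 4 ^ i / 4 ^ r) *
        (if 1 / 2 ^ (r - i) ≤ |p x - p' x| then q x else 0) := by
    intro x
    have h2 := sq_le_layers (abs_nonneg (p x - p' x)) r (j := r) (by
      rw [div_self (by positivity), abs_le]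
      constructor <;> linarith [h0 x, h0' x, h1 x, h1' x])
    rw [sq_abs] at h2
    refine (mul_le_mul_of_nonneg_left h2 (hq x)).trans (le_of_eq ?_)
    rw [mul_add, Finset.mul_sum]
    congr 1
    refine Finset.sum_congr rfl fun i hi => ?_
    have hir := (Finset.mem_range.1 hi).le
    have e : (2 : ℝ) ^ i / 2 ^ r = 1 / 2 ^ (r - i) := by
      rw [div_eq_div_iff (by positivity) (by positivity), one_mul, ← pow_add,
        Nat.add_sub_cancel' hir]
    rw [e]
    split_ifs <;> ring
  refine (Finset.sum_le_sum fun x _ => hpt x).trans ?_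
  rw [Finset.sum_add_distrib, ← Finset.sum_mul, Finset.sum_comm]
  have h3 : ∀ i ∈ Finset.range r, ∑ x, (4 * 4 ^ i / 4 ^ r) *
      (if 1 / 2 ^ (r - i) ≤ |p x - p' x| then q x else 0) ≤ 4 / 4 ^ r * (1 / 2) ^ i := by
    intro i hi
    have hir := Finset.mem_range.1 hi
    rw [← Finset.mul_sum, ← Finset.sum_filter]
    have h4 := sum_far_le hq hp hp' h0 h0' h1 h1' hir.le (h i hir)
    refine (mul_le_mul_of_nonneg_left h4 (by positivity)).trans (le_of_eq ?_)
    have e : (8 : ℝ) ^ i = 4 ^ i * 2 ^ i := by rw [← mul_pow]; norm_num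
    rw [e, one_div_pow]
    field_simp
  have h5 : ∑ i ∈ Finset.range r, 4 / (4 : ℝ) ^ r * (1 / 2) ^ i ≤ 4 / 4 ^ r * 2 := by
    rw [← Finset.mul_sum]
    exact mul_le_mul_of_nonneg_left (sum_geometric_two_le r) (by positivity)
  have h6 : (∑ x, q x) * (1 / 4 ^ r) ≤ 1 * (1 / (4 : ℝ) ^ r) :=
    mul_le_mul_of_nonneg_right hq1 (by positivity)
  have h7 : 1 * (1 / (4 : ℝ) ^ r) + 4 / 4 ^ r * 2 = 9 / 4 ^ r := by ring
  linarith [Finset.sum_le_sum h3]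

end Code

lemma choose_le_exp {r i : ℕ} (hi : i ≤ r) :
    (((2 ^ (r + 2 * i) + 2 ^ (r - i)).choose (2 ^ (r - i)) : ℕ) : ℝ) ≤
      Real.exp (2 ^ r * ((3 * i + 2) / 2 ^ i)) := by
  obtain ⟨j, rfl⟩ := Nat.exists_eq_add_of_le hi
  rw [Nat.add_sub_cancel_left]
  set M : ℕ := 2 ^ j with hM
  have hMr : (M : ℝ) = 2 ^ j := by rw [hM]; push_cast; rfl
  have hM0 : (0 : ℝ) < M := by rw [hMr]; positivity
  have hK : (2 : ℕ) ^ (i + j + 2 * i) + M = M * (8 ^ i + 1) := by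
    have : (8 : ℕ) ^ i = 2 ^ (3 * i) := by rw [pow_mul]; norm_num
    rw [hM, this, mul_add, ← pow_add, mul_one]
    congr 2
    ring
  rw [hK]
  have h1 := Nat.choose_le_pow_div (α := ℝ) M (M * (8 ^ i + 1))
  have h2 := Real.pow_div_factorial_le_exp (M : ℝ) hM0.le M
  have h3 : (8 : ℝ) ^ i + 1 ≤ Real.exp (3 * i + 1) := by
    have e1 : (2 : ℝ) ≤ Real.exp 1 := by linarith [Real.exp_one_gt_d9]
    have e2 : (8 : ℝ) ^ i + 1 ≤ 2 ^ (3 * i + 1) := by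
      have : (1 : ℝ) ≤ 8 ^ i := one_le_pow₀ (by norm_num)
      have e3 : (2 : ℝ) ^ (3 * i + 1) = 8 ^ i * 2 := by rw [pow_succ, pow_mul]; norm_num
      linarith
    refine e2.trans ((pow_le_pow_left₀ (by norm_num) e1 _).trans (le_of_eq ?_))
    rw [← Real.exp_nat_mul]
    push_cast
    ring_nf
  have h4 : ((8 : ℝ) ^ i + 1) ^ M ≤ Real.exp (M * (3 * i + 1)) := by
    rw [Real.exp_nat_mul]
    exact pow_le_pow_left₀ (by positivity) h3 M
  calc _ ≤ _ := h1
    _ = (M : ℝ) ^ M / M.factorial * ((8 : ℝ) ^ i + 1) ^ M := by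
        push_cast
        rw [mul_pow]
        ring
    _ ≤ Real.exp M * Real.exp (M * (3 * i + 1)) := by gcongr
    _ = _ := by
        rw [← Real.exp_add]
        congr 1
        rw [hMr, pow_add]
        field_simp
        ring

lemma prod_choose_le_exp (r : ℕ) :
    ((∏ i : Fin r, (2 ^ (r + 2 * (i : ℕ)) + 2 ^ (r - (i : ℕ))).choose (2 ^ (r - (i : ℕ))) : ℕ) : ℝ) ≤
      Real.exp (10 * 2 ^ r) := by
  push_cast
  have h1 : ∀ k : ℕ, ∑ i ∈ Finset.range k, (3 * (i : ℝ) + 2) / 2 ^ i = 10 - (6 * k + 10) / 2 ^ k := by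
    intro k
    induction k with
    | zero => simp
    | succ k ih =>
      rw [Finset.sum_range_succ, ih, pow_succ]
      push_cast
      field_simp
      ring
  calc _ ≤ ∏ i : Fin r, Real.exp (2 ^ r * ((3 * ((i : ℕ) : ℝ) + 2) / 2 ^ (i : ℕ))) := by
        refine Finset.prod_le_prod (fun i _ => Nat.cast_nonneg _) fun i _ => ?_
        have := choose_le_exp (r := r) (i := i) i.2.le
        exact_mod_cast this
    _ = Real.exp (2 ^ r * ∑ i ∈ Finset.range r, (3 * (i : ℝ) + 2) / 2 ^ i) := by
        rw [← Real.exp_sum, ← Finset.mul_sum,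
          Fin.sum_univ_eq_sum_range (fun i => (3 * (i : ℝ) + 2) / 2 ^ i)]
    _ ≤ _ := by
        rw [h1]
        apply Real.exp_le_exp.2
        have : (0 : ℝ) ≤ (6 * r + 10) / 2 ^ r := by positivity
        nlinarith [show (0 : ℝ) < 2 ^ r by positivity]

lemma entry_eq_sum {m : ℕ} (g : Fin m → ℝ) {k : ℕ} (hk : 1 ≤ k) :
    entry g k = entry g 1 + ∑ j ∈ Finset.Icc 2 k, diff g j := by
  induction k, hk using Nat.le_induction with
  | base => simp
  | succ k hk ih =>
    rw [Finset.sum_Icc_succ_top (by omega), ← add_assoc, ← ih, diff, Nat.add_sub_cancel]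
    ring

/-- The sum of the positive parts of the increments `a₂, …, a_{x+1}`: for `a = ± D g` these are the
increasing functions of the Jordan decomposition of `g`. -/
noncomputable def rise {m : ℕ} (a : ℕ → ℝ) (x : Fin m) : ℝ :=
  ∑ k ∈ Finset.Icc 2 ((x : ℕ) + 1), max (a k) 0

lemma rise_mono {m : ℕ} (a : ℕ → ℝ) : Monotone (rise a : Fin m → ℝ) := by
  intro x y h
  have : (x : ℕ) ≤ y := h
  exact Finset.sum_le_sum_of_subset_of_nonneg (Finset.Icc_subset_Icc_right (by omega))
    fun k _ _ => le_max_right _ _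

lemma rise_nonneg {m : ℕ} (a : ℕ → ℝ) (x : Fin m) : 0 ≤ rise a x :=
  Finset.sum_nonneg fun _ _ => le_max_right _ _

lemma rise_le_one {m : ℕ} {a : ℕ → ℝ} (ha : ∑ k ∈ Finset.Icc 2 m, |a k| ≤ 1) (x : Fin m) :
    rise a x ≤ 1 := by
  refine le_trans (Finset.sum_le_sum fun k _ => max_le (le_abs_self _) (abs_nonneg _)) (le_trans ?_ ha)
  exact Finset.sum_le_sum_of_subset_of_nonneg (Finset.Icc_subset_Icc_right x.2)
    fun k _ _ => abs_nonneg _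

lemma eq_entry_add_rise_sub_rise {m : ℕ} (g : Fin m → ℝ) (x : Fin m) :
    g x = entry g 1 + rise (diff g) x - rise (fun k => -diff g k) x := by
  rw [add_sub_assoc, rise, rise, ← Finset.sum_sub_distrib, ← entry_succ g x,
    entry_eq_sum g (by omega)]
  congr 1
  refine Finset.sum_congr rfl fun k _ => ?_
  rcases le_total 0 (diff g k) with h | h
  · rw [max_eq_left h, max_eq_right (by linarith)]; ring
  · rw [max_eq_right h, max_eq_left (by linarith)]; ring

lemma abs_entry_le_one {m : ℕ} {g : Fin m → ℝ} (hg : ∀ x, |g x| ≤ 1) (k : ℕ) : |entry g k| ≤ 1 := by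
  unfold entry
  split_ifs
  · exact hg _
  · simp

lemma distL2_eq {m : ℕ} (Q : Measure (Fin m)) [IsFiniteMeasure Q] (g h : Fin m → ℝ) :
    distL2 Q g h = √(∑ x, Q.real {x} * (g x - h x) ^ 2) := by
  rw [distL2, integral_fintype Integrable.of_finite]
  simp only [smul_eq_mul]

lemma sum_real_singleton {m : ℕ} (Q : Measure (Fin m)) [IsProbabilityMeasure Q] :
    ∑ x, Q.real {x} = 1 := by
  simp

/-- The rounded first entry of a vector, together with the codes of the two increasing functions in
its Jordan decomposition. -/
noncomputable def vectorCode {m : ℕ} (r : ℕ) (q g : Fin m → ℝ) :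
    ℕ × (Fin r → Finset ℕ) × (Fin r → Finset ℕ) :=
  (⌊(2 : ℝ) ^ r * (entry g 1 + 1)⌋₊, fun i => code r q (rise (diff g)) i,
    fun i => code r q (rise fun k => -diff g k) i)

/-- The finite set in which the codes of vectors lie. -/
def vectorCodes (r : ℕ) : Finset (ℕ × (Fin r → Finset ℕ) × (Fin r → Finset ℕ)) :=
  Finset.range (2 ^ (r + 1) + 1) ×ˢ
    (Fintype.piFinset fun i : Fin r => Finset.powersetCard (2 ^ (r - (i : ℕ)))
      (Finset.range (2 ^ (r + 2 * (i : ℕ)) + 2 ^ (r - (i : ℕ))))) ×ˢ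
    (Fintype.piFinset fun i : Fin r => Finset.powersetCard (2 ^ (r - (i : ℕ)))
      (Finset.range (2 ^ (r + 2 * (i : ℕ)) + 2 ^ (r - (i : ℕ)))))

lemma card_vectorCodes_le (r : ℕ) : ((vectorCodes r).card : ℝ) ≤ Real.exp (22 * 2 ^ r) := by
  have h := prod_choose_le_exp r
  simp only [vectorCodes, Finset.card_product, Fintype.card_piFinset, Finset.card_powersetCard,
    Finset.card_range]
  rw [Nat.cast_mul, Nat.cast_mul]
  have h1 : ((2 ^ (r + 1) + 1 : ℕ) : ℝ) ≤ Real.exp (2 * 2 ^ r) := by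
    refine le_trans (le_of_eq ?_) (Real.add_one_le_exp _)
    push_cast
    ring
  calc _ ≤ Real.exp (2 * 2 ^ r) * (Real.exp (10 * 2 ^ r) * Real.exp (10 * 2 ^ r)) := by gcongr
    _ = _ := by
      rw [← Real.exp_add, ← Real.exp_add]
      congr 1
      ring

lemma vectorCode_mem {m : ℕ} {q : Fin m → ℝ} (hq : ∀ x, 0 ≤ q x) (hq1 : ∑ x, q x ≤ 1) (r : ℕ)
    {g : Fin m → ℝ} (hg : g ∈ boundedTV m) : vectorCode r q g ∈ vectorCodes r := by
  simp only [vectorCode, vectorCodes, Finset.mem_product, Fintype.mem_piFinset, Finset.mem_range]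
  refine ⟨?_, fun i => code_mem hq hq1 _ _ _, fun i => code_mem hq hq1 _ _ _⟩
  rw [Nat.lt_succ_iff]
  refine Nat.floor_le_of_le ?_
  have := (abs_le.1 (abs_entry_le_one hg.1 1)).2
  push_cast
  rw [pow_succ]
  exact mul_le_mul_of_nonneg_left (by linarith) (by positivity)

lemma distL2_le_of_vectorCode_eq {m : ℕ} (Q : Measure (Fin m)) [IsProbabilityMeasure Q] (r : ℕ)
    {g h : Fin m → ℝ} (hg : g ∈ boundedTV m) (hh : h ∈ boundedTV m)
    (he : vectorCode r (fun x => Q.real {x}) g = vectorCode r (fun x => Q.real {x}) h) :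
    distL2 Q g h ≤ 8 / 2 ^ r := by
  have hq : ∀ x, 0 ≤ Q.real {x} := fun x => measureReal_nonneg
  have hq1 := sum_real_singleton Q
  simp only [vectorCode, Prod.mk.injEq] at he
  obtain ⟨e0, e1, e2⟩ := he
  have hneg : ∀ {g : Fin m → ℝ}, g ∈ boundedTV m → ∑ k ∈ Finset.Icc 2 m, |-diff g k| ≤ 1 := by
    intro g hg
    simp only [abs_neg]
    exact hg.2
  have h1 := sum_sq_sub_le hq hq1.le (rise_mono _) (rise_mono _) (rise_nonneg _) (rise_nonneg _)
    (rise_le_one hg.2) (rise_le_one hh.2) fun i hi => congrFun e1 ⟨i, hi⟩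
  have h2 := sum_sq_sub_le hq hq1.le (rise_mono _) (rise_mono _) (rise_nonneg _) (rise_nonneg _)
    (rise_le_one (hneg hg)) (rise_le_one (hneg hh)) fun i hi => congrFun e2 ⟨i, hi⟩
  have h4 : (4 : ℝ) ^ r = 2 ^ r * 2 ^ r := by rw [← mul_pow]; norm_num
  have hr0 : (0 : ℝ) < 2 ^ r := by positivity
  have h3 : (entry g 1 - entry h 1) ^ 2 ≤ 1 / 4 ^ r := by
    have b1 := (abs_le.1 (abs_entry_le_one hg.1 1)).1
    have b2 := (abs_le.1 (abs_entry_le_one hh.1 1)).1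
    have c1 := Nat.floor_le (a := (2 : ℝ) ^ r * (entry g 1 + 1)) (by
      apply mul_nonneg hr0.le; linarith)
    have c2 := Nat.lt_floor_add_one ((2 : ℝ) ^ r * (entry g 1 + 1))
    have c3 := Nat.floor_le (a := (2 : ℝ) ^ r * (entry h 1 + 1)) (by
      apply mul_nonneg hr0.le; linarith)
    have c4 := Nat.lt_floor_add_one ((2 : ℝ) ^ r * (entry h 1 + 1))
    rw [e0] at c1 c2
    have c5 : (2 ^ r * (entry g 1 - entry h 1)) ^ 2 ≤ 1 := by
      rw [sq_le_one_iff_abs_le_one, abs_le]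
      constructor <;> linarith
    rw [le_div_iff₀' (by positivity), h4]
    linarith
  rw [distL2_eq]
  refine Real.sqrt_le_iff.2 ⟨by positivity, ?_⟩
  have hpt : ∀ x, Q.real {x} * (g x - h x) ^ 2 ≤ 3 * (Q.real {x} * (1 / 4 ^ r) +
      Q.real {x} * (rise (diff g) x - rise (diff h) x) ^ 2 +
      Q.real {x} * (rise (fun k => -diff g k) x - rise (fun k => -diff h k) x) ^ 2) := by
    intro x
    rw [← mul_add, ← mul_add, mul_left_comm]
    refine mul_le_mul_of_nonneg_left ?_ (hq x)
    rw [eq_entry_add_rise_sub_rise g x, eq_entry_add_rise_sub_rise h x]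
    set a := entry g 1 - entry h 1
    set b := rise (diff g) x - rise (diff h) x with hb
    set c := rise (fun k => -diff g k) x - rise (fun k => -diff h k) x with hc
    have : (entry g 1 + rise (diff g) x - rise (fun k => -diff g k) x -
        (entry h 1 + rise (diff h) x - rise (fun k => -diff h k) x)) ^ 2 = (a + b - c) ^ 2 := by
      rw [hb, hc]; ring
    rw [this]
    nlinarith [sq_nonneg (a - b), sq_nonneg (a + c), sq_nonneg (b + c)]
  refine (Finset.sum_le_sum fun x _ => hpt x).trans ?_
  rw [← Finset.mul_sum, Finset.sum_add_distrib, Finset.sum_add_distrib, ← Finset.sum_mul, hq1]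
  have h5 : (8 / (2 : ℝ) ^ r) ^ 2 = 64 / 4 ^ r := by rw [div_pow, h4]; ring
  have h6 : 3 * (1 * (1 / (4 : ℝ) ^ r) + 9 / 4 ^ r + 9 / 4 ^ r) ≤ 64 / 4 ^ r := by
    rw [show 3 * (1 * (1 / (4 : ℝ) ^ r) + 9 / 4 ^ r + 9 / 4 ^ r) = 57 / 4 ^ r by ring]
    gcongr
    norm_num
  linarith

lemma entropy_le_of_card_le_exp {E : Type*} {d : E → E → ℝ} {V : Set E} {u a : ℝ} {N : ℕ}
    (hN : coveringNumber d V u ≤ N) (ha : (N : ℝ) ≤ Real.exp a) : entropy d V u ≤ (a : EReal) := by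
  have h1 : ((coveringNumber d V u : ℕ∞) : ENNReal) ≤ ENNReal.ofReal (Real.exp a) := by
    calc ((coveringNumber d V u : ℕ∞) : ENNReal) ≤ ((N : ℕ∞) : ENNReal) :=
          ENat.toENNReal_le.2 hN
      _ = ENNReal.ofReal N := by simp
      _ ≤ _ := ENNReal.ofReal_le_ofReal ha
  have h2 := ENNReal.log_le_log h1
  rwa [ENNReal.log_ofReal_of_pos (Real.exp_pos _), Real.log_exp] at h2

theorem isEntropyConstant_352 : IsEntropyConstant 352 := by
  intro m Q hQ u hu
  rcases le_or_gt u 8 with h8 | h8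
  · obtain ⟨k, hk1, hk2⟩ := exists_nat_pow_near (x := 8 / u) (y := 2)
      ((one_le_div hu).2 h8) (by norm_num)
    have hr0 : (0 : ℝ) < 2 ^ (k + 1) := by positivity
    have hcov : coveringNumber (distL2 Q) (boundedTV m) u ≤ ((vectorCodes (k + 1)).card : ℕ∞) := by
      refine coveringNumber_le_card (vectorCode (k + 1) fun x => Q.real {x}) _
        (fun g hg => vectorCode_mem (fun x => measureReal_nonneg) (sum_real_singleton Q).le _ hg)
        fun g hg h hh he => (distL2_le_of_vectorCode_eq Q _ hg hh he).trans ?_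
      rw [div_le_iff₀ hr0]
      rw [div_lt_iff₀ hu] at hk2
      linarith
    refine entropy_le_of_card_le_exp hcov ((card_vectorCodes_le _).trans (Real.exp_le_exp.2 ?_))
    rw [pow_succ, show (352 : ℝ) / u = 44 * (8 / u) by ring]
    linarith
  · have hcov : coveringNumber (distL2 Q) (boundedTV m) u ≤ ((1 : ℕ) : ℕ∞) := by
      refine coveringNumber_le_card (fun _ => ()) {()} (by simp) fun g hg h hh _ => ?_
      rw [distL2_eq]
      refine Real.sqrt_le_iff.2 ⟨hu.le, ?_⟩
      have hpt : ∀ x, Q.real {x} * (g x - h x) ^ 2 ≤ Q.real {x} * 4 := by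
        intro x
        refine mul_le_mul_of_nonneg_left ?_ measureReal_nonneg
        have h1 := abs_le.1 (hg.1 x)
        have h2 := abs_le.1 (hh.1 x)
        nlinarith
      refine (Finset.sum_le_sum fun x _ => hpt x).trans ?_
      rw [← Finset.sum_mul, sum_real_singleton]
      nlinarith
    refine entropy_le_of_card_le_exp hcov ?_
    rw [Nat.cast_one]
    exact Real.one_le_exp (by positivity)

/-- In dimension one, the constants `1` and `-1` are not within `19/20` of a common point. -/
theorem IsEntropyConstant.le {A₀ : ℝ} (h : IsEntropyConstant A₀) : 5 / 8 ≤ A₀ := by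
  have h1 := h 1 (Measure.dirac 0) inferInstance (19 / 20) (by norm_num)
  have hd : ∀ g c : Fin 1 → ℝ, distL2 (Measure.dirac 0) g c = |g 0 - c 0| := by
    intro g c
    rw [distL2, integral_dirac, Real.sqrt_sq_eq_abs]
  have h2 : (2 : ℕ∞) ≤ coveringNumber (distL2 (Measure.dirac 0)) (boundedTV 1) (19 / 20) := by
    refine le_iInf₂ fun C hC => ?_
    have hmem : ∀ a : ℝ, |a| ≤ 1 → (fun _ => a) ∈ boundedTV 1 := by
      intro a ha
      refine ⟨fun _ => ha, ?_⟩
      simp [TV]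
    obtain ⟨c, hc, hc1⟩ := hC.2 _ (hmem 1 (by norm_num))
    obtain ⟨c', hc', hc1'⟩ := hC.2 _ (hmem (-1) (by norm_num))
    rw [hd, abs_le] at hc1 hc1'
    have : 1 < C.card := Finset.one_lt_card.2 ⟨c, hc, c', hc', by
      rintro rfl
      linarith [hc1.2, hc1'.1]⟩
    exact_mod_cast this
  have h3 : ENNReal.log (ENNReal.ofReal 2) ≤ ((A₀ / (19 / 20) : ℝ) : EReal) := by
    refine le_trans (ENNReal.log_le_log ?_) h1
    have := ENat.toENNReal_le.2 h2
    simpa using this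
  rw [ENNReal.log_ofReal_of_pos two_pos, EReal.coe_le_coe_iff] at h3
  have := Real.log_two_gt_d9
  rw [le_div_iff₀ (by norm_num)] at h3
  linarith

end TVLogit

theorem theorem4p1 :
    (∃ A₀ : ℝ, TVLogit.IsEntropyConstant A₀) ∧
    ∀ A₀ : ℝ, TVLogit.IsEntropyConstant A₀ →
    ∀ (Ω : Type*) [MeasurableSpace Ω] (P : Measure Ω) [IsProbabilityMeasure P]
      (n : ℕ) (_ : 0 < n)
      (Y : Fin n → Ω → ℝ) (_ : ∀ i, Measurable (Y i))
      (_ : ∀ i ω, Y i ω = 0 ∨ Y i ω = 1) (_ : iIndepFun Y P)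
      (oracle : Fin n → ℝ) (S : Finset ℕ) (_ : S = TVLogit.jumpSet oracle) (_ : n ∉ S)
      (ν μ t : ℝ) (_ : 0 < ν) (_ : 0 < μ) (_ : 0 < t)
      (δsq lam : ℝ) (_ : TVLogit.deltaSqBound A₀ ν n S t ≤ δsq)
      (_ : TVLogit.lambdaBound A₀ ν n S t ≤ lam),
      1 - Real.exp (-t) ≤ P.real {ω | ∀ f : Fin n → ℝ,
        (∑ i, TVLogit.noise P Y i ω * f i) / n ≤
          μ * δsq + TVLogit.normQnSq f / μ + lam * TVLogit.weightedTV S f} := by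
  refine ⟨⟨352, TVLogit.isEntropyConstant_352⟩, ?_⟩
  intro A₀ hA Ω _ P _ n hn Y hm h01 hI oracle S hS _ ν μ t hν hμ ht δsq lam hδ hlam
  refine TVLogit.noise_bound hA.le hn hm h01 hI ?_ hν hμ ht hδ hlam
  rw [hS]
  exact Finset.filter_subset _ _
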